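/- Let $Z_1,Z_2,Z_3\in\mathbb R^2$ be the vertices of a nondegenerate triangle with $|Z_1Z_3|=|Z_2Z_3|$, let $d_1=d_2$ and $d_3$ be real numbers in the ranges listed below, and let $X$ be the set of global minimizers over $W\in\mathbb R^2$ of $$O(W)=\sum_{j=1}^{3}\bigl|\,\|W-Z_j\|^2-d_j^2\,\bigr| .$$ Put $r=|Z_1Z_2|$, $s=\bigl\|Z_3-\tfrac{Z_1+Z_2}{2}\bigr\|$, and, when $d_1\ge r/2$, $h=\sqrt{d_1^2-r^2/4}$. Let $Y_0=\tfrac13(Z_1+Z_2+Z_3)$ and $Y_3=3Y_0-2Z_3$. Let $N_3$ be the point closest to $Y_3$ in $R_{001}=\{W: \|W-Z_1\|\ge d_1,\ \|W-Z_2\|\ge d_2,\ \|W-Z_3\|\le d_3\}$. Let $S_j$ be the circle with centre $Z_j$ and radius $d_j$. For $\{i,j,k\}=\{1,2,3\}$ let $S_{ij+}$ and $S_{ij-}$ be the points of $S_i\cap S_j$ closest to and farthest from $Z_k$, respectively (equal if $S_i\cap S_j$ is a single point). Let $R,M>0$ be defined by $$R^2=h^2+s^2\,\frac{4s^2+r^2}{4s^2+9r^2}-2sh\,\frac{4s^2-3r^2}{4s^2+9r^2},\qquad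 M^2=h^2+2sh\,\frac{4s^2-3r^2}{4s^2+r^2}+s^2\,\frac{4s^2+9r^2}{4s^2+r^2},$$ and put $$A=\sqrt{\tfrac{r^2}{4}+\tfrac{s^2}{9}},\quad B=\sqrt{\tfrac{r^2}{4}+s^2},\quad P=\sqrt{\tfrac{r^2}{4}+s^2\Bigl(\tfrac{4s^2+5r^2}{4s^2-3r^2}\Bigr)^2}\ \Bigl(s>\tfrac{\sqrt3}{2}r\Bigr),\quad F=\sqrt{\tfrac{r^2}{4}+s^2\Bigl(\tfrac{4r^2}{3r^2-4s^2}\Bigr)^2}\ \Bigl(s<\tfrac{\sqrt3}{2}r\Bigr).$$ If $s>\frac{\sqrt3}{2}r$ and $d_1>P$, put $u=h-s$; then $d_3^*=\sqrt{u^2+2t^*su}$, where $t^*$ is a zero in $(0,1)$ of $$g(t)=\frac{2s}{s^2+\frac{r^2}{4}}\Bigl(-u\bigl[(s^2-\tfrac{r^2}{4})t+\tfrac{r^2}{2}\bigr]+r\sqrt{-s^2u^2t^2+2su\bigl(s^2+\tfrac{r^2}{4}+su\bigr)t+\tfrac{r^2u^2}{4}}\Bigr);$$ such a $d_3^*$ exists,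 is unique, and satisfies $h-s<d_3^*<\sqrt{h^2-s^2}$. Then in each of the following cases the named points exist and are uniquely determined (points with different names may coincide), and $X$ is the indicated set. **For every $s>0$:** - $d_1\in(0,A]$, $d_3\in(0,\frac{2s}{3}]$: $X=\{Y_0\}$. - $d_1\in(0,B]$, $d_3\in[2s,\infty)$: $X=\{Y_3\}$. - $d_1\in(0,\frac r2]$, $d_3\in[\frac{2s}{3},2s]$: $X=\{N_3\}$. - $d_1\in(\frac r2,A]$, $d_3\in[\frac{2s}{3},s-h]$: $X=\{N_3\}$. - $d_1\in(\frac r2,B]$, $d_3\in[s+h,2s]$: $X=\{N_3\}$. - $d_1\in(\frac r2,A)$, $d_3\in(s-h,s+h)$: $X=\{S_{23+},S_{31+}\}$. - $d_1\in[A,\infty)$, $d_3\in(0,|s-h|]$: $X=\{S_{12+}\}$. - $d_1\in[A,B)$: $X=\{S_{12+}\}$ if $d_3\in[s-h,R)$; $X=\{S_{12+},S_{23+},S_{31+}\}$ if $d_3=R$; $X=\{S_{23+},S_{31+}\}$ if $d_3\in(R,s+h]$. **If $s<\frac{\sqrt3}{2}r$:** - $d_1\in[B,F)$: $X=\{S_{12+}\}$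 if $d_3\in[h-s,R)$; $X=\{S_{12+},S_{23+},S_{31+}\}$ if $d_3=R$; $X=\{S_{23+},S_{31+}\}$ if $d_3\in(R,M)$; $X=\{S_{23+},S_{31+},S_{12-}\}$ if $d_3=M$; $X=\{S_{12-}\}$ if $d_3>M$. - $d_1=F$: $X=\{S_{12+}\}$ if $d_3\in[h-s,\sqrt{h^2+s^2})$; $X=\{S_{12+},S_{12-},S_{23+},S_{31+}\}$ if $d_3=\sqrt{h^2+s^2}$; $X=\{S_{12-}\}$ if $d_3>\sqrt{h^2+s^2}$. - $d_1>F$: $X=\{S_{12+}\}$ if $d_3\in[h-s,\sqrt{h^2+s^2})$; $X=\{S_{12+},S_{12-}\}$ if $d_3=\sqrt{h^2+s^2}$; $X=\{S_{12-}\}$ if $d_3>\sqrt{h^2+s^2}$. **If $s=\frac{\sqrt3}{2}r$ (equilateral triangle):** - $d_1\in[B,\infty)$: the same five cases as for $d_1\in[B,F)$ above. **If $s>\frac{\sqrt3}{2}r$:** - $d_1\in[B,P)$: $X=\{S_{12+}\}$ if $d_3\in[h-s,R)$; $X=\{S_{12+},S_{23+},S_{31+}\}$ if $d_3=R$; $X=\{S_{23+},S_{31+}\}$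 if $d_3\in(R,\sqrt{h^2+s^2}]$. - $d_1=P$: $X=\{S_{12+}\}$ if $d_3\in[h-s,\sqrt{h^2-s^2})$; $X=\{S_{12+},S_{23+},S_{23-},S_{31+},S_{31-}\}$ if $d_3=\sqrt{h^2-s^2}$; $X=\{S_{23+},S_{31+}\}$ if $d_3\in(\sqrt{h^2-s^2},\sqrt{h^2+s^2}]$. - $d_1>P$: $X=\{S_{12+}\}$ if $d_3\in(h-s,d_3^*)$; $X=\{S_{12+},S_{23-},S_{31-}\}$ if $d_3=d_3^*$; $X=\{S_{23-},S_{31-}\}$ if $d_3\in(d_3^*,\sqrt{h^2-s^2})$; $X=\{S_{23+},S_{23-},S_{31+},S_{31-}\}$ if $d_3=\sqrt{h^2-s^2}$; $X=\{S_{23+},S_{31+}\}$ if $d_3\in(\sqrt{h^2-s^2},\sqrt{h^2+s^2}]$. - $d_1\in[B,\infty)$: $X=\{S_{23+},S_{31+}\}$ if $d_3\in(\sqrt{h^2+s^2},M)$; $X=\{S_{23+},S_{31+},S_{12-}\}$ if $d_3=M$; $X=\{S_{12-}\}$ if $d_3>M$. -/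

import Mathlib

open Set

noncomputable section

/-- The Euclidean plane. -/
abbrev Plane := EuclideanSpace ℝ (Fin 2)

/-- The data of a localization problem: three sensors and three measured distances. -/
structure Measurement where
  Z₁ : Plane
  Z₂ : Plane
  Z₃ : Plane
  d₁ : ℝ
  d₂ : ℝ
  d₃ : ℝ

namespace Measurement

/-- The objective function `O(W) = ∑ⱼ | ‖W - Zⱼ‖² - dⱼ² |`. -/
def objective (m : Measurement) (W : Plane) : ℝ :=
  |‖W - m.Z₁‖ ^ 2 - m.d₁ ^ 2| + |‖W - m.Z₂‖ ^ 2 - m.d₂ ^ 2| + |‖W - m.Z₃‖ ^ 2 - m.d₃ ^ 2|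

/-- The set `X` of global minimizers of the objective function. -/
def sources (m : Measurement) : Set Plane :=
  {W | ∀ V : Plane, m.objective W ≤ m.objective V}

/-- The measurement circles. -/
def S₁ (m : Measurement) : Set Plane := Metric.sphere m.Z₁ m.d₁
def S₂ (m : Measurement) : Set Plane := Metric.sphere m.Z₂ m.d₂
def S₃ (m : Measurement) : Set Plane := Metric.sphere m.Z₃ m.d₃

/-- The centroid of the measurement triangle. -/
def Y₀ (m : Measurement) : Plane := (1 / 3 : ℝ) • (m.Z₁ + m.Z₂ + m.Z₃)

/-- `Y₃ = 3 Y₀ - 2 Z₃`. -/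
def Y₃ (m : Measurement) : Plane := (3 : ℝ) • m.Y₀ - (2 : ℝ) • m.Z₃

/-- `R₀₀₁`: inside the closed third disk and outside the first two open disks. -/
def R₀₀₁ (m : Measurement) : Set Plane :=
  {W | m.d₁ ≤ dist W m.Z₁ ∧ m.d₂ ≤ dist W m.Z₂ ∧ dist W m.Z₃ ≤ m.d₃}

end Measurement

/-- `p` is the point of `T` closest to `C` (strictly closer than every other point of `T`). -/
def IsNearestPoint (T : Set Plane) (C p : Plane) : Prop :=
  p ∈ T ∧ ∀ q ∈ T, q ≠ p → dist p C < dist q C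

/-- `p` is the point of `T` farthest from `C` (strictly farther than every other point of `T`). -/
def IsFarthestPoint (T : Set Plane) (C p : Plane) : Prop :=
  p ∈ T ∧ ∀ q ∈ T, q ≠ p → dist q C < dist p C

/-- Names of the points that occur in the table of solutions; `Sijp` and `Sijm` stand for
`S_{ij+}` and `S_{ij-}`. -/
inductive PointName where
  | Y0 | Y3 | N3 | S12p | S12m | S23p | S23m | S31p | S31m

/-- `m.Names l p`: the point `p` is the one called `l` for the measurement `m`. -/
def Measurement.Names (m : Measurement) : PointName → Plane → Prop
  | .Y0, p => p = m.Y₀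
  | .Y3, p => p = m.Y₃
  | .N3, p => IsNearestPoint m.R₀₀₁ m.Y₃ p
  | .S12p, p => IsNearestPoint (m.S₁ ∩ m.S₂) m.Z₃ p
  | .S12m, p => IsFarthestPoint (m.S₁ ∩ m.S₂) m.Z₃ p
  | .S23p, p => IsNearestPoint (m.S₂ ∩ m.S₃) m.Z₁ p
  | .S23m, p => IsFarthestPoint (m.S₂ ∩ m.S₃) m.Z₁ p
  | .S31p, p => IsNearestPoint (m.S₃ ∩ m.S₁) m.Z₂ p
  | .S31m, p => IsFarthestPoint (m.S₃ ∩ m.S₁) m.Z₂ p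

/-- The solution set `X` is the set of the points with the names in `L`, all of which exist. -/
def Measurement.SourcesAre (m : Measurement) (L : Set PointName) : Prop :=
  (∀ l ∈ L, ∃! p, m.Names l p) ∧ m.sources = {p | ∃ l ∈ L, m.Names l p}

/-- The threshold `R`. -/
def thresholdR (r s d₁ : ℝ) : ℝ :=
  √(d₁ ^ 2 - r ^ 2 / 4 + s ^ 2 * ((4 * s ^ 2 + r ^ 2) / (4 * s ^ 2 + 9 * r ^ 2))
    - 2 * s * √(d₁ ^ 2 - r ^ 2 / 4) * ((4 * s ^ 2 - 3 * r ^ 2) / (4 * s ^ 2 + 9 * r ^ 2)))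

/-- The threshold `M`. -/
def thresholdM (r s d₁ : ℝ) : ℝ :=
  √(d₁ ^ 2 - r ^ 2 / 4
    + 2 * s * √(d₁ ^ 2 - r ^ 2 / 4) * ((4 * s ^ 2 - 3 * r ^ 2) / (4 * s ^ 2 + r ^ 2))
    + s ^ 2 * ((4 * s ^ 2 + 9 * r ^ 2) / (4 * s ^ 2 + r ^ 2)))

/-- The threshold `P` for `d₁` in the sharp case `s > √3 r / 2`. -/
def thresholdP (r s : ℝ) : ℝ :=
  √(r ^ 2 / 4 + s ^ 2 * ((4 * s ^ 2 + 5 * r ^ 2) / (4 * s ^ 2 - 3 * r ^ 2)) ^ 2)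

/-- The threshold for `d₁` in the flat case `s < √3 r / 2`. -/
def thresholdFlat (r s : ℝ) : ℝ :=
  √(r ^ 2 / 4 + s ^ 2 * (4 * r ^ 2 / (3 * r ^ 2 - 4 * s ^ 2)) ^ 2)

/-- The function `g` on `[0, 1]` whose zero determines `d₃*`, with `u = √(d₁² - r²/4) - s`. -/
def auxG (r s u t : ℝ) : ℝ :=
  2 * s / (s ^ 2 + r ^ 2 / 4) *
    (-u * ((s ^ 2 - r ^ 2 / 4) * t + r ^ 2 / 2)
      + r * √(-s ^ 2 * u ^ 2 * t ^ 2 + 2 * s * u * (s ^ 2 + r ^ 2 / 4 + s * u) * t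
          + r ^ 2 * u ^ 2 / 4))

/-- `δ` is the threshold `d₃*`: it is `√(u² + 2 t* s u)` for a zero `t* ∈ (0, 1)` of `g`,
with `u = √(d₁² - r²/4) - s`. -/
def IsThresholdD3 (r s d₁ δ : ℝ) : Prop :=
  ∃ u t : ℝ, u = √(d₁ ^ 2 - r ^ 2 / 4) - s ∧ t ∈ Ioo (0 : ℝ) 1 ∧ auxG r s u t = 0 ∧
    δ = √(u ^ 2 + 2 * t * s * u)

end

/-- The objective function in coordinates with `Z₁ = (-a, 0)`, `Z₂ = (a, 0)`, `Z₃ = (0, s)`. -/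
def planarObjective (a s d e x y : ℝ) : ℝ :=
  |(x + a) ^ 2 + y ^ 2 - d ^ 2| + |(x - a) ^ 2 + y ^ 2 - d ^ 2| + |x ^ 2 + (y - s) ^ 2 - e ^ 2|

section Coordinates

variable {a s d e h y₀ ξ x y v : ℝ}

/-- A Lagrangian lower bound for the objective function. -/
theorem planarObjective_ge_lagrangian {l μ : ℝ} (hl : |l| ≤ 1) (hμ : |μ| ≤ 1) :
    l * ((x + a) ^ 2 + y ^ 2 - d ^ 2) + l * ((x - a) ^ 2 + y ^ 2 - d ^ 2) +
      μ * (x ^ 2 + (y - s) ^ 2 - e ^ 2) ≤ planarObjective a s d e x y := by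
  have key : ∀ c q : ℝ, |c| ≤ 1 → c * q ≤ |q| := fun c q hc => by
    calc c * q ≤ |c * q| := le_abs_self _
      _ = |c| * |q| := abs_mul _ _
      _ ≤ 1 * |q| := by gcongr
      _ = |q| := one_mul _
  unfold planarObjective
  linarith [key l ((x + a) ^ 2 + y ^ 2 - d ^ 2) hl, key l ((x - a) ^ 2 + y ^ 2 - d ^ 2) hl,
    key μ (x ^ 2 + (y - s) ^ 2 - e ^ 2) hμ]

/-- If the Lagrangian is critical at `(0, z)` with value `v`, the objective function exceeds `v`
by at least a multiple of the squared distance to `(0, z)`. -/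
theorem planarObjective_ge_of_critical {l μ z : ℝ} (hl : |l| ≤ 1) (hμ : |μ| ≤ 1)
    (hc : 2 * l * z + μ * (z - s) = 0)
    (hv : v = 2 * l * (a ^ 2 + z ^ 2 - d ^ 2) + μ * ((z - s) ^ 2 - e ^ 2)) :
    v + (2 * l + μ) * (x ^ 2 + (y - z) ^ 2) ≤ planarObjective a s d e x y := by
  refine le_trans (le_of_eq ?_) (planarObjective_ge_lagrangian (x := x) (y := y) hl hμ)
  rw [hv]
  linear_combination (-2 * (y - z)) * hc

theorem two_mul_abs_le_of_sq (hd : d ^ 2 = a ^ 2 + h ^ 2) :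
    2 * |x ^ 2 + y ^ 2 - h ^ 2| ≤
      |(x + a) ^ 2 + y ^ 2 - d ^ 2| + |(x - a) ^ 2 + y ^ 2 - d ^ 2| := by
  have := abs_add_le ((x + a) ^ 2 + y ^ 2 - d ^ 2) ((x - a) ^ 2 + y ^ 2 - d ^ 2)
  rw [show (x + a) ^ 2 + y ^ 2 - d ^ 2 + ((x - a) ^ 2 + y ^ 2 - d ^ 2) =
    2 * (x ^ 2 + y ^ 2 - h ^ 2) by rw [hd]; ring, abs_mul, abs_two] at this
  exact this

theorem four_mul_abs_le (ha : 0 < a) :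
    4 * a * |x| ≤ |(x + a) ^ 2 + y ^ 2 - d ^ 2| + |(x - a) ^ 2 + y ^ 2 - d ^ 2| := by
  have := abs_sub ((x + a) ^ 2 + y ^ 2 - d ^ 2) ((x - a) ^ 2 + y ^ 2 - d ^ 2)
  rw [show (x + a) ^ 2 + y ^ 2 - d ^ 2 - ((x - a) ^ 2 + y ^ 2 - d ^ 2) = 4 * a * x by ring,
    abs_mul, abs_of_pos (by positivity : (0:ℝ) < 4 * a)] at this
  exact this

/-- The left-hand side of the equation that the half-width `ξ` of the smallest box around `(0, y)`
touching the circle satisfies. -/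
def cornerForm (k s y ξ : ℝ) : ℝ := (1 + k ^ 2) * ξ ^ 2 + 2 * k * |s - y| * ξ + y ^ 2

theorem cornerForm_convex_lt {k η t : ℝ} (hξ : 0 ≤ ξ) (hk : 0 ≤ k)
    (h0 : cornerForm k s y₀ ξ = h ^ 2) (hη : η ^ 2 = h ^ 2) (hne : y₀ ≠ η) (ht0 : 0 < t)
    (ht1 : t < 1) :
    cornerForm k s ((1 - t) * y₀ + t * η) ((1 - t) * ξ) < h ^ 2 := by
  have hpos : ∀ σ : ℝ, 0 < t * (1 - t) * ((y₀ - η + σ * k * ξ) ^ 2 + ξ ^ 2) := fun σ => by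
    apply mul_pos (mul_pos ht0 (by linarith))
    rcases hξ.eq_or_lt with h | h
    · rw [← h]
      have := sub_ne_zero.2 hne
      simp only [mul_zero, add_zero]
      positivity
    · positivity
  have hkξ : 0 ≤ k * ξ := mul_nonneg hk hξ
  have e1 : (1 + k ^ 2) * ξ ^ 2 + 2 * k * (s - y₀) * ξ + y₀ ^ 2 ≤ h ^ 2 := by
    rw [← h0]; unfold cornerForm
    nlinarith [mul_le_mul_of_nonneg_left (le_abs_self (s - y₀)) hkξ]
  have e2 : (1 + k ^ 2) * ξ ^ 2 - 2 * k * (s - y₀) * ξ + y₀ ^ 2 ≤ h ^ 2 := by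
    rw [← h0]; unfold cornerForm
    nlinarith [mul_le_mul_of_nonneg_left (neg_abs_le (s - y₀)) hkξ]
  have ht2 : 0 ≤ 1 - t := by linarith
  unfold cornerForm
  rcases abs_choice (s - ((1 - t) * y₀ + t * η)) with hc | hc <;> rw [hc]
  · have := mul_le_mul_of_nonneg_left e1 ht2
    have p := hpos (-1)
    linear_combination this + p + t * hη
  · have := mul_le_mul_of_nonneg_left e2 ht2
    have p := hpos 1
    linear_combination this + p + t * hη

theorem sq_add_sq_le_of_mem_box {k y₁ : ℝ} (hx : |x| ≤ ξ) (hy : |y - y₁| ≤ k * ξ) :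
    x ^ 2 + (y - s) ^ 2 ≤ cornerForm k s y₁ ξ + s ^ 2 - 2 * s * y₁ ∧
      (x ^ 2 + (y - s) ^ 2 = cornerForm k s y₁ ξ + s ^ 2 - 2 * s * y₁ →
        |x| = ξ ∧ |y - s| = |s - y₁| + k * ξ) := by
  have h1 : |y - s| ≤ |s - y₁| + k * ξ := by
    have := abs_sub_le y y₁ s
    rw [abs_sub_comm y₁ s] at this
    linarith
  have h2 : |x| ^ 2 ≤ ξ ^ 2 := by gcongr
  have h3 : |y - s| ^ 2 ≤ (|s - y₁| + k * ξ) ^ 2 := by gcongr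
  have h4 : cornerForm k s y₁ ξ + s ^ 2 - 2 * s * y₁ = ξ ^ 2 + (|s - y₁| + k * ξ) ^ 2 := by
    unfold cornerForm
    linear_combination (-1 : ℝ) * sq_abs (s - y₁)
  rw [h4, ← sq_abs x, ← sq_abs (y - s)]
  refine ⟨by linarith, fun h => ⟨?_, ?_⟩⟩
  · have : |x| ^ 2 = ξ ^ 2 := by linarith
    exact (sq_eq_sq₀ (abs_nonneg _) ((abs_nonneg _).trans hx)).1 this
  · have : |y - s| ^ 2 = (|s - y₁| + k * ξ) ^ 2 := by linarith
    exact (sq_eq_sq₀ (abs_nonneg _) ((abs_nonneg _).trans h1)).1 this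

/-- The level of a circle around `Z₃` through `(x, y)`. -/
theorem level_spec (hs : 0 < s) (h : ℝ) :
    ∃ y₁, x ^ 2 + (y - s) ^ 2 = h ^ 2 + s ^ 2 - 2 * s * y₁ :=
  ⟨(h ^ 2 + s ^ 2 - (x ^ 2 + (y - s) ^ 2)) / (2 * s), by field_simp; ring⟩

/-- Sharp lower bound for the objective function when the third circle meets the segment between
the two intersection points of the first two circles. -/
theorem planarObjective_ge_of_mem_segment (ha : 0 < a) (hs : 0 < s)
    (hd : d ^ 2 = a ^ 2 + h ^ 2) (he : e ^ 2 = h ^ 2 + s ^ 2 - 2 * s * y₀)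
    (hy1 : -h ≤ y₀) (hy2 : y₀ ≤ h) (hξ : 0 ≤ ξ) (hξe : cornerForm (a / s) s y₀ ξ = h ^ 2)
    (v1 : v ≤ 2 * s * (h - y₀)) (v2 : v ≤ 2 * s * (h + y₀)) (v3 : v ≤ 4 * a * ξ) :
    v ≤ planarObjective a s d e x y ∧ (planarObjective a s d e x y = v →
      (x = 0 ∧ y = h ∧ v = 2 * s * (h - y₀)) ∨ (x = 0 ∧ y = -h ∧ v = 2 * s * (h + y₀)) ∨
      (v = 4 * a * ξ ∧ |x| = ξ ∧ |y - s| = |s - y₀| + a / s * ξ ∧ |y - y₀| ≤ a / s * ξ)) := by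
  obtain ⟨y₁, hy₁⟩ := level_spec (x := x) (y := y) hs h
  set G := |(x + a) ^ 2 + y ^ 2 - d ^ 2| + |(x - a) ^ 2 + y ^ 2 - d ^ 2| with hG
  have hGx : 4 * a * |x| ≤ G := four_mul_abs_le ha
  have hGy : 4 * s * |y - y₁| ≤ G := by
    have := two_mul_abs_le_of_sq (x := x) (y := y) hd
    rw [show x ^ 2 + y ^ 2 - h ^ 2 = 2 * s * (y - y₁) by linear_combination hy₁, abs_mul,
      abs_of_pos (by positivity : 0 < 2 * s)] at this
    linarith
  have hO : planarObjective a s d e x y = G + 2 * s * |y₁ - y₀| := by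
    unfold planarObjective
    rw [← hG, show x ^ 2 + (y - s) ^ 2 - e ^ 2 = 2 * s * (y₀ - y₁) by rw [hy₁, he]; ring, abs_mul,
      abs_of_pos (by positivity : 0 < 2 * s), abs_sub_comm]
  rw [hO]
  have hG0 : 0 ≤ G := by positivity
  have hGzero : G = 0 → x = 0 ∧ y = y₁ := fun h0 => by
    rw [h0] at hGx hGy
    constructor
    · have : |x| ≤ 0 := by
        by_contra! hh
        linarith [mul_pos (by positivity : 0 < 4 * a) hh]
      exact abs_eq_zero.1 (le_antisymm this (abs_nonneg _))
    · have : |y - y₁| ≤ 0 := by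
        by_contra! hh
        linarith [mul_pos (by positivity : 0 < 4 * s) hh]
      exact sub_eq_zero.1 (abs_eq_zero.1 (le_antisymm this (abs_nonneg _)))
  have box : ∀ c, G ≤ 4 * a * c → |x| ≤ c ∧ |y - y₁| ≤ a / s * c := fun c hc => by
    constructor
    · exact le_of_mul_le_mul_left (hGx.trans hc) (by positivity)
    · rw [div_mul_eq_mul_div, le_div_iff₀ hs]
      nlinarith [hGy.trans hc]
  have inner : ∀ η t, η ^ 2 = h ^ 2 → y₀ ≠ η → 0 < t → t < 1 → y₁ = (1 - t) * y₀ + t * η →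
      v ≤ 2 * s * |η - y₀| → v < G + 2 * s * |y₁ - y₀| := by
    intro η t hη hne ht0 ht1 hy hvη
    have hlt := cornerForm_convex_lt (k := a / s) (s := s) hξ (by positivity) hξe hη hne ht0 ht1
    rw [← hy] at hlt
    have hG1 : 4 * a * ((1 - t) * ξ) < G := by
      by_contra! hle
      obtain ⟨b1, b2⟩ := box _ hle
      have := (sq_add_sq_le_of_mem_box (s := s) b1 b2).1
      linarith
    have : y₁ - y₀ = t * (η - y₀) := by rw [hy]; ring
    rw [this, abs_mul, abs_of_pos ht0]
    nlinarith [mul_le_mul_of_nonneg_left v3 (by linarith : 0 ≤ 1 - t),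
      mul_le_mul_of_nonneg_left hvη ht0.le]
  rcases le_or_gt h y₁ with c1 | c1
  · have habs : |y₁ - y₀| = y₁ - y₀ := abs_of_nonneg (by linarith)
    rw [habs]
    have : 2 * s * (h - y₀) ≤ 2 * s * (y₁ - y₀) := by gcongr
    refine ⟨by linarith, fun hv => Or.inl ?_⟩
    obtain ⟨hx0, hyy⟩ := hGzero (by linarith)
    have : 2 * s * h = 2 * s * y₁ := by linarith
    have : h = y₁ := mul_left_cancel₀ (by positivity) this
    exact ⟨hx0, by rw [hyy, this], by linarith⟩
  rcases le_or_gt y₁ (-h) with c2 | c2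
  · have habs : |y₁ - y₀| = y₀ - y₁ := by
      rw [abs_sub_comm]; exact abs_of_nonneg (by linarith)
    rw [habs]
    have : 2 * s * (h + y₀) ≤ 2 * s * (y₀ - y₁) := by
      apply mul_le_mul_of_nonneg_left _ (by positivity); linarith
    refine ⟨by linarith, fun hv => Or.inr (Or.inl ?_)⟩
    obtain ⟨hx0, hyy⟩ := hGzero (by linarith)
    have : 2 * s * -h = 2 * s * y₁ := by linarith
    have : -h = y₁ := mul_left_cancel₀ (by positivity) this
    exact ⟨hx0, by rw [hyy, this], by linarith⟩
  rcases lt_trichotomy y₁ y₀ with c | c | c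
  · have hlt : 0 < y₀ + h := by linarith
    have := inner (-h) ((y₀ - y₁) / (y₀ + h)) (by ring) (by linarith)
      (div_pos (by linarith) hlt) ((div_lt_one hlt).2 (by linarith)) (by field_simp; ring)
      (by rw [abs_sub_comm, abs_of_nonneg (by linarith)]; linarith)
    exact ⟨this.le, fun hh => absurd hh this.ne'⟩
  · subst c
    simp only [sub_self, abs_zero, mul_zero, add_zero]
    have hG3 : 4 * a * ξ ≤ G := by
      by_contra! hlt
      obtain ⟨b1, b2⟩ := box _ hlt.le
      obtain ⟨b3, b4⟩ := sq_add_sq_le_of_mem_box (s := s) b1 b2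
      have := (b4 (by rw [hξe, hy₁])).1
      rw [this] at hGx
      linarith
    refine ⟨by linarith, fun hv => Or.inr (Or.inr ?_)⟩
    obtain ⟨b1, b2⟩ := box ξ (by linarith)
    obtain ⟨b3, b4⟩ := sq_add_sq_le_of_mem_box (s := s) b1 b2
    obtain ⟨b5, b6⟩ := b4 (by rw [hξe, hy₁])
    exact ⟨by linarith, b5, b6, b2⟩
  · have hlt : 0 < h - y₀ := by linarith
    have := inner h ((y₁ - y₀) / (h - y₀)) (by ring) (by linarith)
      (div_pos (by linarith) hlt) ((div_lt_one hlt).2 (by linarith)) (by field_simp; ring)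
      (by rw [abs_of_nonneg (by linarith)]; linarith)
    exact ⟨this.le, fun hh => absurd hh this.ne'⟩

end Coordinates

/-- The third circle meets the segment between the common points `(0, ±h)` of the first two circles
at height `y₀`; the numbers `p ≥ 0 ≥ q` are the abscissae of its common points with the first. -/
structure SegmentData (a s d e h y₀ p q : ℝ) : Prop where
  a_pos : 0 < a
  s_pos : 0 < s
  h_nonneg : 0 ≤ h
  d_sq : d ^ 2 = a ^ 2 + h ^ 2
  e_sq : e ^ 2 = h ^ 2 + s ^ 2 - 2 * s * y₀
  neg_le : -h ≤ y₀
  le : y₀ ≤ h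
  p_nonneg : 0 ≤ p
  q_nonpos : q ≤ 0
  factor : ∀ x, (1 + (a / s) ^ 2) * x ^ 2 + 2 * (a / s) * (s - y₀) * x + y₀ ^ 2 - h ^ 2 =
    (1 + (a / s) ^ 2) * ((x - p) * (x - q))

theorem SegmentData.exists {a s d e h y₀ : ℝ} (ha : 0 < a) (hs : 0 < s) (hh : 0 ≤ h)
    (hd : d ^ 2 = a ^ 2 + h ^ 2) (he : e ^ 2 = h ^ 2 + s ^ 2 - 2 * s * y₀) (h1 : -h ≤ y₀)
    (h2 : y₀ ≤ h) : ∃ p q, SegmentData a s d e h y₀ p q := by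
  set k := a / s with hk
  set b := k * (s - y₀) with hb
  have hc : 0 ≤ (1 + k ^ 2) * (h ^ 2 - y₀ ^ 2) := by
    apply mul_nonneg (by positivity)
    nlinarith
  have hΔ : 0 ≤ b ^ 2 + (1 + k ^ 2) * (h ^ 2 - y₀ ^ 2) := by positivity
  have hle : |b| ≤ √(b ^ 2 + (1 + k ^ 2) * (h ^ 2 - y₀ ^ 2)) :=
    Real.abs_le_sqrt (by linarith)
  have hsq := Real.sq_sqrt hΔ
  set w := √(b ^ 2 + (1 + k ^ 2) * (h ^ 2 - y₀ ^ 2))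
  obtain ⟨hb1, hb2⟩ := abs_le.1 hle
  have hk1 : 0 < 1 + k ^ 2 := by positivity
  refine ⟨(-b + w) / (1 + k ^ 2), (-b - w) / (1 + k ^ 2), ⟨ha, hs, hh, hd, he, h1, h2,
    div_nonneg (by linarith) hk1.le, div_nonpos_of_nonpos_of_nonneg (by linarith) hk1.le,
    fun x => ?_⟩⟩
  rw [← hk]
  have : (1 + k ^ 2) * (x - (-b + w) / (1 + k ^ 2)) * ((1 + k ^ 2) * (x - (-b - w) / (1 + k ^ 2)))
      = (1 + k ^ 2) * ((1 + k ^ 2) * x ^ 2 + 2 * k * (s - y₀) * x + y₀ ^ 2 - h ^ 2) := by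
    rw [mul_sub, mul_sub, mul_div_cancel₀ _ hk1.ne', mul_div_cancel₀ _ hk1.ne']
    linear_combination (-1 : ℝ) * hsq - (2 * (1 + k ^ 2) * x) * hb
  apply mul_left_cancel₀ hk1.ne'
  rw [← this]
  ring

namespace SegmentData

variable {a s d e h y₀ p q : ℝ} (S : SegmentData a s d e h y₀ p q)
include S

theorem cornerForm_p (hy : y₀ ≤ s) : cornerForm (a / s) s y₀ p = h ^ 2 := by
  have := S.factor p
  unfold cornerForm
  rw [abs_of_nonneg (by linarith)]
  linear_combination this

theorem cornerForm_neg_q (hy : s ≤ y₀) : cornerForm (a / s) s y₀ (-q) = h ^ 2 := by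
  have := S.factor q
  unfold cornerForm
  rw [abs_of_nonpos (by linarith)]
  linear_combination this

theorem p_eq_zero (hy : y₀ ^ 2 = h ^ 2) (hs : y₀ ≤ s) : p = 0 := by
  have hk : 0 < a / s := div_pos S.a_pos S.s_pos
  have h1 := S.factor p
  have h2 : p * ((1 + (a / s) ^ 2) * p + 2 * (a / s) * (s - y₀)) = 0 := by
    linear_combination h1 - hy
  by_contra hne
  have hp := lt_of_le_of_ne S.p_nonneg (Ne.symm hne)
  have : 0 < (1 + (a / s) ^ 2) * p + 2 * (a / s) * (s - y₀) :=
    add_pos_of_pos_of_nonneg (by positivity) (mul_nonneg (by positivity) (by linarith))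
  exact (mul_pos hp this).ne' h2

theorem p_eq_neg_q (hs : y₀ = s) : p = -q := by
  have h1 := S.factor 1
  have h2 := S.factor (-1)
  have hk : 0 < 1 + (a / s) ^ 2 := by positivity
  have : (1 + (a / s) ^ 2) * (p + q) = 0 := by
    rw [hs] at h1 h2
    linear_combination (h1 - h2) / 2
  rcases mul_eq_zero.1 this with h | h
  · exact absurd h hk.ne'
  · linarith

theorem near_sub_p (hy : y₀ < h) : ∃ c > 0, 2 * s * (h - y₀) - 4 * a * p =
    c * (h * (s ^ 2 - 3 * a ^ 2) + 4 * a ^ 2 * s - y₀ * (s ^ 2 + 9 * a ^ 2)) := by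
  have ha := S.a_pos
  have hs := S.s_pos
  have hq := S.q_nonpos
  have hx : 0 < s * (h - y₀) / (2 * a) := div_pos (mul_pos hs (by linarith)) (by linarith)
  have hf := S.factor (s * (h - y₀) / (2 * a))
  have hpos : 0 < (1 + (a / s) ^ 2) * (s * (h - y₀) / (2 * a) - q) :=
    mul_pos (by positivity) (by linarith)
  refine ⟨4 * a * ((h - y₀) / (4 * a ^ 2)) / ((1 + (a / s) ^ 2) * (s * (h - y₀) / (2 * a) - q)),
    div_pos (mul_pos (by positivity) (div_pos (by linarith) (by positivity))) hpos, ?_⟩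
  rw [div_mul_eq_mul_div, eq_div_iff hpos.ne']
  have h1 : 2 * s * (h - y₀) - 4 * a * p = 4 * a * (s * (h - y₀) / (2 * a) - p) := by
    field_simp; ring
  rw [h1]
  have h2 : (1 + (a / s) ^ 2) * (s * (h - y₀) / (2 * a)) ^ 2 +
      2 * (a / s) * (s - y₀) * (s * (h - y₀) / (2 * a)) + y₀ ^ 2 - h ^ 2 =
      ((h - y₀) / (4 * a ^ 2)) *
      (h * (s ^ 2 - 3 * a ^ 2) + 4 * a ^ 2 * s - y₀ * (s ^ 2 + 9 * a ^ 2)) := by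
    field_simp; ring
  linear_combination (4 * a) * h2 - (4 * a) * hf

theorem far_sub_p (hy : -h < y₀) : ∃ c > 0, 2 * s * (h + y₀) - 4 * a * p =
    c * (h * (s ^ 2 - 3 * a ^ 2) + 4 * a ^ 2 * s + y₀ * (s ^ 2 + a ^ 2)) := by
  have ha := S.a_pos
  have hs := S.s_pos
  have hq := S.q_nonpos
  have hx : 0 < s * (h + y₀) / (2 * a) := div_pos (mul_pos hs (by linarith)) (by linarith)
  have hf := S.factor (s * (h + y₀) / (2 * a))
  have hpos : 0 < (1 + (a / s) ^ 2) * (s * (h + y₀) / (2 * a) - q) :=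
    mul_pos (by positivity) (by linarith)
  refine ⟨4 * a * ((h + y₀) / (4 * a ^ 2)) / ((1 + (a / s) ^ 2) * (s * (h + y₀) / (2 * a) - q)),
    div_pos (mul_pos (by positivity) (div_pos (by linarith) (by positivity))) hpos, ?_⟩
  rw [div_mul_eq_mul_div, eq_div_iff hpos.ne']
  have h1 : 2 * s * (h + y₀) - 4 * a * p = 4 * a * (s * (h + y₀) / (2 * a) - p) := by
    field_simp; ring
  rw [h1]
  have h2 : (1 + (a / s) ^ 2) * (s * (h + y₀) / (2 * a)) ^ 2 +
      2 * (a / s) * (s - y₀) * (s * (h + y₀) / (2 * a)) + y₀ ^ 2 - h ^ 2 =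
      ((h + y₀) / (4 * a ^ 2)) *
      (h * (s ^ 2 - 3 * a ^ 2) + 4 * a ^ 2 * s + y₀ * (s ^ 2 + a ^ 2)) := by
    field_simp; ring
  linear_combination (4 * a) * h2 - (4 * a) * hf

theorem near_add_q (hy : y₀ < h) : ∃ c > 0, 2 * s * (h - y₀) + 4 * a * q =
    c * ((h - y₀) * (s ^ 2 + a ^ 2) - 4 * a ^ 2 * (h + s)) := by
  have ha := S.a_pos
  have hs := S.s_pos
  have hp := S.p_nonneg
  have hx : 0 < s * (h - y₀) / (2 * a) := div_pos (mul_pos hs (by linarith)) (by linarith)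
  have hf := S.factor (-(s * (h - y₀) / (2 * a)))
  have hpos : 0 < (1 + (a / s) ^ 2) * (s * (h - y₀) / (2 * a) + p) :=
    mul_pos (by positivity) (by linarith)
  refine ⟨4 * a * ((h - y₀) / (4 * a ^ 2)) / ((1 + (a / s) ^ 2) * (s * (h - y₀) / (2 * a) + p)),
    div_pos (mul_pos (by positivity) (div_pos (by linarith) (by positivity))) hpos, ?_⟩
  rw [div_mul_eq_mul_div, eq_div_iff hpos.ne']
  have h1 : 2 * s * (h - y₀) + 4 * a * q = 4 * a * (s * (h - y₀) / (2 * a) + q) := by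
    field_simp; ring
  rw [h1]
  have h2 : (1 + (a / s) ^ 2) * (-(s * (h - y₀) / (2 * a))) ^ 2 +
      2 * (a / s) * (s - y₀) * (-(s * (h - y₀) / (2 * a))) + y₀ ^ 2 - h ^ 2 =
      ((h - y₀) / (4 * a ^ 2)) * ((h - y₀) * (s ^ 2 + a ^ 2) - 4 * a ^ 2 * (h + s)) := by
    field_simp; ring
  linear_combination (4 * a) * h2 - (4 * a) * hf

/-- The common points of the first and the third circle. -/
theorem mem_inter_iff (x y : ℝ) : ((x + a) ^ 2 + y ^ 2 = d ^ 2 ∧ x ^ 2 + (y - s) ^ 2 = e ^ 2) ↔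
    (x = p ∨ x = q) ∧ y = y₀ - a / s * x := by
  have hs := S.s_pos
  have hk : 0 < 1 + (a / s) ^ 2 := by positivity
  have has : a / s * s = a := div_mul_cancel₀ _ hs.ne'
  have hd := S.d_sq
  have he := S.e_sq
  have hf := S.factor x
  constructor
  · rintro ⟨h1, h2⟩
    have hy : y = y₀ - a / s * x := by
      apply mul_left_cancel₀ hs.ne'
      linear_combination (h1 - h2 + hd - he) / 2 + x * has
    refine ⟨?_, hy⟩
    rw [hy] at h2
    have : (1 + (a / s) ^ 2) * ((x - p) * (x - q)) = 0 := by
      rw [← hf]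
      linear_combination h2 + he
    rcases mul_eq_zero.1 ((mul_eq_zero.1 this).resolve_left hk.ne') with h | h
    · exact Or.inl (by linarith)
    · exact Or.inr (by linarith)
  · rintro ⟨hx, hy⟩
    have h0 : (x - p) * (x - q) = 0 := by
      rcases hx with h | h <;> simp [h]
    rw [h0, mul_zero] at hf
    constructor
    · rw [hy]
      linear_combination hf - hd - 2 * x * has
    · rw [hy]
      linear_combination hf - he

theorem planarObjective_near : planarObjective a s d e 0 h = 2 * s * (h - y₀) := by
  have : 0 ≤ 2 * s * (h - y₀) := mul_nonneg (by linarith [S.s_pos]) (by linarith [S.le])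
  unfold planarObjective
  rw [show (0 + a) ^ 2 + h ^ 2 - d ^ 2 = 0 by rw [S.d_sq]; ring,
    show (0 - a) ^ 2 + h ^ 2 - d ^ 2 = 0 by rw [S.d_sq]; ring,
    show 0 ^ 2 + (h - s) ^ 2 - e ^ 2 = -(2 * s * (h - y₀)) by rw [S.e_sq]; ring, abs_neg,
    abs_of_nonneg this]
  simp

theorem planarObjective_far : planarObjective a s d e 0 (-h) = 2 * s * (h + y₀) := by
  have : 0 ≤ 2 * s * (h + y₀) := mul_nonneg (by linarith [S.s_pos]) (by linarith [S.neg_le])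
  unfold planarObjective
  rw [show (0 + a) ^ 2 + (-h) ^ 2 - d ^ 2 = 0 by rw [S.d_sq]; ring,
    show (0 - a) ^ 2 + (-h) ^ 2 - d ^ 2 = 0 by rw [S.d_sq]; ring,
    show 0 ^ 2 + (-h - s) ^ 2 - e ^ 2 = 2 * s * (h + y₀) by rw [S.e_sq]; ring,
    abs_of_nonneg this]
  simp

theorem planarObjective_corner {x y : ℝ} (h1 : (x + a) ^ 2 + y ^ 2 = d ^ 2)
    (h2 : x ^ 2 + (y - s) ^ 2 = e ^ 2) : planarObjective a s d e x y = 4 * a * |x| := by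
  unfold planarObjective
  rw [h1, h2, show (x - a) ^ 2 + y ^ 2 - d ^ 2 = -(4 * a * x) by rw [← h1]; ring, abs_neg, abs_mul,
    abs_of_pos (by linarith [S.a_pos] : 0 < 4 * a)]
  simp

end SegmentData

theorem planarObjective_neg (a s d e x y : ℝ) :
    planarObjective a s d e (-x) y = planarObjective a s d e x y := by
  unfold planarObjective
  rw [show (-x + a) ^ 2 = (x - a) ^ 2 by ring, show (-x - a) ^ 2 = (x + a) ^ 2 by ring,
    show (-x) ^ 2 = x ^ 2 by ring, add_comm (|(x - a) ^ 2 + y ^ 2 - d ^ 2|)]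

namespace SegmentData

variable {a s d e h y₀ p q : ℝ} (S : SegmentData a s d e h y₀ p q)
include S

theorem planarObjective_p : planarObjective a s d e p (y₀ - a / s * p) = 4 * a * p := by
  obtain ⟨h1, h2⟩ := (S.mem_inter_iff p _).2 ⟨Or.inl rfl, rfl⟩
  rw [S.planarObjective_corner h1 h2, abs_of_nonneg S.p_nonneg]

theorem planarObjective_q : planarObjective a s d e q (y₀ - a / s * q) = -(4 * a * q) := by
  obtain ⟨h1, h2⟩ := (S.mem_inter_iff q _).2 ⟨Or.inr rfl, rfl⟩
  rw [S.planarObjective_corner h1 h2, abs_of_nonpos S.q_nonpos, mul_neg]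

theorem planarObjective_ge {v x y : ℝ}
    (v1 : v ≤ 2 * s * (h - y₀)) (v2 : v ≤ 2 * s * (h + y₀)) (v3 : y₀ ≤ s → v ≤ 4 * a * p)
    (v4 : s ≤ y₀ → v ≤ -(4 * a * q)) :
    v ≤ planarObjective a s d e x y ∧ (planarObjective a s d e x y = v →
      (x = 0 ∧ y = h ∧ v = 2 * s * (h - y₀)) ∨ (x = 0 ∧ y = -h ∧ v = 2 * s * (h + y₀)) ∨
      (y₀ ≤ s ∧ v = 4 * a * p ∧ (x = p ∨ x = -p) ∧ y = y₀ - a / s * p) ∨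
      (s ≤ y₀ ∧ v = -(4 * a * q) ∧ (x = q ∨ x = -q) ∧ y = y₀ - a / s * q)) := by
  have ha := S.a_pos
  have hs := S.s_pos
  obtain ⟨ξ, hξ, hξe, v5, hξs⟩ : ∃ ξ, 0 ≤ ξ ∧ cornerForm (a / s) s y₀ ξ = h ^ 2 ∧ v ≤ 4 * a * ξ ∧
      ((y₀ ≤ s ∧ ξ = p) ∨ (s ≤ y₀ ∧ ξ = -q)) := by
    rcases le_total y₀ s with hc | hc
    · exact ⟨p, S.p_nonneg, S.cornerForm_p hc, v3 hc, Or.inl ⟨hc, rfl⟩⟩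
    · exact ⟨-q, by linarith [S.q_nonpos], S.cornerForm_neg_q hc, by linarith [v4 hc],
        Or.inr ⟨hc, rfl⟩⟩
  obtain ⟨g1, g2⟩ := planarObjective_ge_of_mem_segment (x := x) (y := y) ha hs S.d_sq S.e_sq
    S.neg_le S.le hξ hξe v1 v2 v5
  refine ⟨g1, fun hv => ?_⟩
  rcases g2 hv with g | g | ⟨k1, k2, k3, k4⟩
  · exact Or.inl g
  · exact Or.inr (Or.inl g)
  · refine Or.inr (Or.inr ?_)
    have hkξ : 0 ≤ a / s * ξ := by positivity
    have hy : (y₀ ≤ s ∧ y = y₀ - a / s * ξ) ∨ (s ≤ y₀ ∧ y = y₀ + a / s * ξ) := by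
      obtain ⟨k5, k6⟩ := abs_le.1 k4
      rcases abs_cases (y - s) with ⟨c1, c2⟩ | ⟨c1, c2⟩ <;>
      rcases abs_cases (s - y₀) with ⟨c3, c4⟩ | ⟨c3, c4⟩
      · right; constructor <;> linarith
      · right; constructor <;> linarith
      · left; constructor <;> linarith
      · right; constructor <;> linarith
    have hx := eq_or_eq_neg_of_abs_eq k2
    rcases hy with ⟨hc, hy⟩ | ⟨hc, hy⟩
    · left
      have hξp : ξ = p := by
        rcases hξs with ⟨-, h⟩ | ⟨h, h'⟩
        · exact h
        · rw [h', S.p_eq_neg_q (le_antisymm hc h)]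
      rw [hξp] at hx hy k1
      exact ⟨hc, k1, hx, hy⟩
    · right
      have hξq : ξ = -q := by
        rcases hξs with ⟨h, h'⟩ | ⟨-, h⟩
        · rw [h', S.p_eq_neg_q (le_antisymm h hc)]
        · exact h
      rw [hξq] at hx hy k1
      refine ⟨hc, by linarith, ?_, by linarith⟩
      rw [neg_neg] at hx
      exact hx.symm

end SegmentData

/-- Coordinates of the plane in which the sensors are `(-a, 0)`, `(a, 0)` and `(0, s)`. -/
structure IsoscelesFrame (m : Measurement) (a s d e : ℝ) where
  toPlane : ℝ → ℝ → Plane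
  surj : ∀ W, ∃ x y, toPlane x y = W
  dist_sq : ∀ x y x' y', dist (toPlane x y) (toPlane x' y') ^ 2 = (x - x') ^ 2 + (y - y') ^ 2
  Z₁_eq : m.Z₁ = toPlane (-a) 0
  Z₂_eq : m.Z₂ = toPlane a 0
  Z₃_eq : m.Z₃ = toPlane 0 s
  Y₀_eq : m.Y₀ = toPlane 0 (s / 3)
  Y₃_eq : m.Y₃ = toPlane 0 (-s)
  d₁_eq : m.d₁ = d
  d₂_eq : m.d₂ = d
  d₃_eq : m.d₃ = e
  a_pos : 0 < a
  s_pos : 0 < s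

theorem Measurement.exists_isoscelesFrame (m : Measurement)
    (hT : AffineIndependent ℝ ![m.Z₁, m.Z₂, m.Z₃])
    (hiso : dist m.Z₁ m.Z₃ = dist m.Z₂ m.Z₃) (hd : m.d₁ = m.d₂) :
    Nonempty (IsoscelesFrame m (dist m.Z₁ m.Z₂ / 2) (dist m.Z₃ (midpoint ℝ m.Z₁ m.Z₂))
      m.d₁ m.d₃) := by
  have hne : m.Z₁ ≠ m.Z₂ := fun h => by
    have := hT.injective (a₁ := 0) (a₂ := 1) (by simpa using h)
    simp at this
  have hne3 : m.Z₃ ≠ midpoint ℝ m.Z₁ m.Z₂ := fun h => by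
    rw [affineIndependent_iff_not_collinear_set] at hT
    apply hT
    have := (wbtw_midpoint ℝ m.Z₁ m.Z₂).collinear
    rwa [← h, Set.pair_comm] at this
  set M := midpoint ℝ m.Z₁ m.Z₂ with hM
  set r := dist m.Z₁ m.Z₂ with hr
  set s := dist m.Z₃ M with hs
  have hr0 : 0 < r := dist_pos.2 hne
  have hs0 : 0 < s := dist_pos.2 hne3
  set U := m.Z₂ - M with hU
  set V := m.Z₃ - M with hV
  have hMeq : M = (1 / 2 : ℝ) • (m.Z₁ + m.Z₂) := by
    rw [hM, midpoint_eq_smul_add]; norm_num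
  have hZ1 : m.Z₁ = M - U := by
    rw [hU, hMeq]; module
  have hZ2 : m.Z₂ = M + U := by rw [hU]; module
  have hZ3 : m.Z₃ = M + V := by rw [hV]; module
  have hUn : ‖U‖ = r / 2 := by
    have : r = 2 * ‖U‖ := by
      rw [hr, dist_eq_norm, hZ1, hZ2, show M - U - (M + U) = (-2 : ℝ) • U by module, norm_smul]
      norm_num
    rw [this]; ring
  have hVn : ‖V‖ = s := by rw [hs, dist_eq_norm]
  have horth : inner ℝ U V = 0 := by
    rw [dist_eq_norm, dist_eq_norm, hZ1, hZ2, hZ3, show M - U - (M + V) = -(U + V) by module,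
      show M + U - (M + V) = U - V by module, norm_neg] at hiso
    have h1 := norm_add_sq_real U V
    have h2 := norm_sub_sq_real U V
    rw [hiso] at h1
    linarith
  set E₁ : Plane := (2 / r) • U with hE1
  set E₂ : Plane := (1 / s) • V with hE2
  have hE1n : ‖E₁‖ = 1 := by
    rw [hE1, norm_smul, hUn, Real.norm_of_nonneg (by positivity)]; field_simp
  have hE2n : ‖E₂‖ = 1 := by
    rw [hE2, norm_smul, hVn, Real.norm_of_nonneg (by positivity)]; field_simp
  have hE12 : inner ℝ E₁ E₂ = 0 := by
    rw [hE1, hE2, inner_smul_left, inner_smul_right, horth]; simp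
  have hUE : U = (r / 2) • E₁ := by
    rw [hE1, smul_smul, show r / 2 * (2 / r) = 1 by field_simp, one_smul]
  have hVE : V = s • E₂ := by
    rw [hE2, smul_smul, show s * (1 / s) = 1 by field_simp, one_smul]
  clear_value E₁ E₂
  have hon : Orthonormal ℝ ![E₁, E₂] := by
    rw [orthonormal_iff_ite]
    intro i j
    fin_cases i <;> fin_cases j <;>
      simp [hE1n, hE2n, hE12, real_inner_comm E₁ E₂]
  have hspan := hon.linearIndependent.span_eq_top_of_card_eq_finrank' (by simp)
  refine ⟨⟨fun x y => M + (x • E₁ + y • E₂), ?_, ?_, ?_, ?_, ?_, ?_, ?_, rfl, hd.symm, rfl,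
    by positivity, hs0⟩⟩
  · intro W
    have hW : W - M ∈ Submodule.span ℝ (Set.range ![E₁, E₂]) := by rw [hspan]; trivial
    rw [Matrix.range_cons, Matrix.range_cons, Matrix.range_empty, Set.union_empty,
      Set.singleton_union, Submodule.mem_span_pair] at hW
    obtain ⟨x, y, hxy⟩ := hW
    exact ⟨x, y, by rw [hxy]; module⟩
  · intro x y x' y'
    rw [dist_eq_norm, show M + (x • E₁ + y • E₂) - (M + (x' • E₁ + y' • E₂)) =
      (x - x') • E₁ + (y - y') • E₂ by module, norm_add_sq_real, norm_smul, norm_smul, hE1n, hE2n,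
      inner_smul_left, inner_smul_right, hE12]
    simp
  · rw [hZ1, hUE]; module
  · rw [hZ2, hUE]; module
  · rw [hZ3, hVE]; module
  · rw [Measurement.Y₀, hZ1, hZ2, hZ3, hVE]; module
  · rw [Measurement.Y₃, Measurement.Y₀, hZ1, hZ2, hZ3, hVE]; module

theorem isNearestPoint_pair_iff {A B C w : Plane} (h : dist A C < dist B C ∨ A = B) :
    IsNearestPoint {A, B} C w ↔ w = A := by
  constructor
  · rintro ⟨hw, hmin⟩
    by_contra hne
    have hwB : w = B := hw.resolve_left hne
    rcases h with h | h
    · have := hmin A (by simp) (Ne.symm hne)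
      rw [hwB] at this
      linarith
    · exact hne (hwB.trans h.symm)
  · rintro rfl
    refine ⟨by simp, ?_⟩
    rintro z (rfl | rfl) hne
    · exact absurd rfl hne
    · exact h.resolve_right (Ne.symm hne)

theorem isFarthestPoint_pair_iff {A B C w : Plane} (h : dist B C < dist A C ∨ A = B) :
    IsFarthestPoint {A, B} C w ↔ w = A := by
  constructor
  · rintro ⟨hw, hmax⟩
    by_contra hne
    have hwB : w = B := hw.resolve_left hne
    rcases h with h | h
    · have := hmax A (by simp) (Ne.symm hne)
      rw [hwB] at this
      linarith
    · exact hne (hwB.trans h.symm)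
  · rintro rfl
    refine ⟨by simp, ?_⟩
    rintro z (rfl | rfl) hne
    · exact absurd rfl hne
    · exact h.resolve_right (Ne.symm hne)

theorem SegmentData.dist_or {a s d e h y₀ p q : ℝ}
    (S : SegmentData a s d e h y₀ p q) :
    ((p - a) ^ 2 + (y₀ - a / s * p) ^ 2 < (q - a) ^ 2 + (y₀ - a / s * q) ^ 2) ∨ p = q := by
  rcases (S.q_nonpos.trans S.p_nonneg).lt_or_eq with hlt | heq
  · left
    have h1 := ((S.mem_inter_iff p _).2 ⟨Or.inl rfl, rfl⟩).1
    have h2 := ((S.mem_inter_iff q _).2 ⟨Or.inr rfl, rfl⟩).1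
    nlinarith [mul_pos S.a_pos (sub_pos.2 hlt)]
  · exact Or.inr heq.symm

/-- The coordinates of the named points. -/
noncomputable def nameCoord (a s e h y₀ p q : ℝ) : PointName → ℝ × ℝ
  | .Y0 => (0, s / 3)
  | .Y3 => (0, -s)
  | .N3 => (0, s - e)
  | .S12p => (0, h)
  | .S12m => (0, -h)
  | .S23p => (-p, y₀ - a / s * p)
  | .S23m => (-q, y₀ - a / s * q)
  | .S31p => (p, y₀ - a / s * p)
  | .S31m => (q, y₀ - a / s * q)

namespace IsoscelesFrame

variable {m : Measurement} {a s d e h y₀ p q : ℝ} (F : IsoscelesFrame m a s d e)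
include F

theorem dist_lt_iff {x y x' y' u v u' v' : ℝ} :
    dist (F.toPlane x y) (F.toPlane x' y') < dist (F.toPlane u v) (F.toPlane u' v') ↔
      (x - x') ^ 2 + (y - y') ^ 2 < (u - u') ^ 2 + (v - v') ^ 2 := by
  rw [← F.dist_sq, ← F.dist_sq, sq_lt_sq₀ dist_nonneg dist_nonneg]

theorem toPlane_inj {x y x' y' : ℝ} :
    F.toPlane x y = F.toPlane x' y' ↔ x = x' ∧ y = y' := by
  constructor
  · intro hh
    have := F.dist_sq x y x' y'
    rw [hh, dist_self] at this
    constructor <;> nlinarith [sq_nonneg (x - x'), sq_nonneg (y - y')]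
  · rintro ⟨rfl, rfl⟩; rfl

theorem dist_eq_iff {x y u v ρ : ℝ} (hρ : 0 ≤ ρ) :
    dist (F.toPlane x y) (F.toPlane u v) = ρ ↔ (x - u) ^ 2 + (y - v) ^ 2 = ρ ^ 2 := by
  rw [← F.dist_sq, sq_eq_sq₀ dist_nonneg hρ]

theorem objective_eq (x y : ℝ) : m.objective (F.toPlane x y) = planarObjective a s d e x y := by
  unfold Measurement.objective planarObjective
  rw [← dist_eq_norm, ← dist_eq_norm, ← dist_eq_norm, F.Z₁_eq, F.Z₂_eq, F.Z₃_eq, F.dist_sq,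
    F.dist_sq, F.dist_sq, F.d₁_eq, F.d₂_eq, F.d₃_eq]
  simp

theorem sourcesAre_of {L : Set PointName} (f : PointName → ℝ × ℝ) (v : ℝ)
    (hf : ∀ l ∈ L, ∀ w, m.Names l w ↔ w = F.toPlane (f l).1 (f l).2) (hL : L.Nonempty)
    (hmin : ∀ x y, v ≤ planarObjective a s d e x y)
    (hval : ∀ l ∈ L, planarObjective a s d e (f l).1 (f l).2 = v)
    (heq : ∀ x y, planarObjective a s d e x y = v → ∃ l ∈ L, (x, y) = f l) :
    m.SourcesAre L := by
  refine ⟨fun l hl => ⟨F.toPlane (f l).1 (f l).2, (hf l hl _).2 rfl, fun w hw => (hf l hl _).1 hw⟩,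
    ?_⟩
  ext W
  obtain ⟨x, y, rfl⟩ := F.surj W
  constructor
  · intro hW
    obtain ⟨l₀, hl₀⟩ := hL
    have h1 := hW (F.toPlane (f l₀).1 (f l₀).2)
    rw [F.objective_eq, F.objective_eq, hval l₀ hl₀] at h1
    obtain ⟨l, hl, hxy⟩ := heq x y (le_antisymm h1 (hmin x y))
    exact ⟨l, hl, (hf l hl _).2 (by rw [← hxy])⟩
  · rintro ⟨l, hl, hn⟩ V
    obtain ⟨u, w, rfl⟩ := F.surj V
    rw [(hf l hl _).1 hn, F.objective_eq, F.objective_eq, hval l hl]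
    exact hmin u w

theorem sourcesAre_singleton {l : PointName} {z : ℝ} (c v : ℝ) (hc : 0 < c)
    (hf : ∀ w, m.Names l w ↔ w = F.toPlane 0 z)
    (hval : planarObjective a s d e 0 z = v)
    (hmin : ∀ x y, v + c * (x ^ 2 + (y - z) ^ 2) ≤ planarObjective a s d e x y) :
    m.SourcesAre {l} := by
  refine F.sourcesAre_of (fun _ => (0, z)) v ?_ (by simp) ?_ ?_ ?_
  · rintro l' rfl w
    exact hf w
  · intro x y
    have : 0 ≤ c * (x ^ 2 + (y - z) ^ 2) := by positivity
    linarith [hmin x y]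
  · rintro l' rfl
    exact hval
  · intro x y hxy
    refine ⟨l, rfl, ?_⟩
    have h1 : c * (x ^ 2 + (y - z) ^ 2) ≤ 0 := by linarith [hmin x y]
    have h2 : x ^ 2 + (y - z) ^ 2 ≤ 0 := nonpos_of_mul_nonpos_right h1 hc
    have hx : x = 0 := by nlinarith [sq_nonneg x, sq_nonneg (y - z)]
    have hy : y - z = 0 := by nlinarith [sq_nonneg x, sq_nonneg (y - z)]
    simp [hx, sub_eq_zero.1 hy]

/-- A certificate for the global optimality of a point on the axis of symmetry. -/
theorem sourcesAre_singleton_of_critical {l : PointName} {z c μ : ℝ} (hl : |c| ≤ 1) (hμ : |μ| ≤ 1)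
    (hpos : 0 < 2 * c + μ) (hc : 2 * c * z + μ * (z - s) = 0)
    (h1 : c * (a ^ 2 + z ^ 2 - d ^ 2) = |a ^ 2 + z ^ 2 - d ^ 2|)
    (h2 : μ * ((z - s) ^ 2 - e ^ 2) = |(z - s) ^ 2 - e ^ 2|)
    (hf : ∀ w, m.Names l w ↔ w = F.toPlane 0 z) : m.SourcesAre {l} := by
  refine F.sourcesAre_singleton _ _ hpos hf ?_
    (fun x y => planarObjective_ge_of_critical hl hμ hc rfl)
  unfold planarObjective
  rw [h2, mul_assoc, h1]
  simp only [zero_add, zero_sub, neg_sq]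
  norm_num
  ring

theorem inter₁₂ (hd : 0 ≤ d) (hdh : d ^ 2 = a ^ 2 + h ^ 2) :
    m.S₁ ∩ m.S₂ = {F.toPlane 0 h, F.toPlane 0 (-h)} := by
  ext W
  obtain ⟨x, y, rfl⟩ := F.surj W
  simp only [Measurement.S₁, Measurement.S₂, mem_inter_iff, Metric.mem_sphere, mem_insert_iff,
    mem_singleton_iff, F.Z₁_eq, F.Z₂_eq, F.d₁_eq, F.d₂_eq, F.dist_eq_iff hd, F.toPlane_inj]
  constructor
  · rintro ⟨h1, h2⟩
    have hx : x = 0 := by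
      have : 4 * a * x = 0 := by linear_combination h1 - h2
      exact (mul_eq_zero.1 this).resolve_left (by linarith [F.a_pos])
    have hy : y ^ 2 = h ^ 2 := by
      rw [hx] at h1
      linear_combination h1 + hdh
    rcases sq_eq_sq_iff_eq_or_eq_neg.1 hy with hy | hy
    · exact Or.inl ⟨hx, hy⟩
    · exact Or.inr ⟨hx, hy⟩
  · rintro (⟨rfl, rfl⟩ | ⟨rfl, rfl⟩) <;> constructor <;> rw [hdh] <;> ring

theorem inter₃₁ (S : SegmentData a s d e h y₀ p q) (hd : 0 ≤ d) (he : 0 ≤ e) :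
    m.S₃ ∩ m.S₁ = {F.toPlane p (y₀ - a / s * p), F.toPlane q (y₀ - a / s * q)} := by
  ext W
  obtain ⟨x, y, rfl⟩ := F.surj W
  have := S.mem_inter_iff x y
  simp only [Measurement.S₁, Measurement.S₃, mem_inter_iff, Metric.mem_sphere, mem_insert_iff,
    mem_singleton_iff, F.Z₁_eq, F.Z₃_eq, F.d₁_eq, F.d₃_eq, F.dist_eq_iff hd, F.dist_eq_iff he,
    F.toPlane_inj]
  rw [sub_neg_eq_add, sub_zero, sub_zero, and_comm, this]
  constructor
  · rintro ⟨rfl | rfl, rfl⟩ <;> simp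
  · rintro (⟨rfl, rfl⟩ | ⟨rfl, rfl⟩) <;> simp

theorem inter₂₃ (S : SegmentData a s d e h y₀ p q) (hd : 0 ≤ d) (he : 0 ≤ e) :
    m.S₂ ∩ m.S₃ = {F.toPlane (-p) (y₀ - a / s * p), F.toPlane (-q) (y₀ - a / s * q)} := by
  ext W
  obtain ⟨x, y, rfl⟩ := F.surj W
  have := S.mem_inter_iff (-x) y
  simp only [Measurement.S₂, Measurement.S₃, mem_inter_iff, Metric.mem_sphere, mem_insert_iff,
    mem_singleton_iff, F.Z₂_eq, F.Z₃_eq, F.d₂_eq, F.d₃_eq, F.dist_eq_iff hd, F.dist_eq_iff he,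
    F.toPlane_inj]
  rw [sub_zero, sub_zero, show (x - a) ^ 2 = (-x + a) ^ 2 by ring, show x ^ 2 = (-x) ^ 2 by ring,
    this, neg_eq_iff_eq_neg, neg_eq_iff_eq_neg]
  constructor
  · rintro ⟨rfl | rfl, rfl⟩ <;> simp
  · rintro (⟨rfl, rfl⟩ | ⟨rfl, rfl⟩) <;> simp

theorem names_S12p (hd : 0 ≤ d) (hh : 0 ≤ h) (hdh : d ^ 2 = a ^ 2 + h ^ 2) (w : Plane) :
    m.Names .S12p w ↔ w = F.toPlane 0 h := by
  unfold Measurement.Names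
  rw [F.inter₁₂ hd hdh]
  apply isNearestPoint_pair_iff
  rw [F.Z₃_eq, F.dist_lt_iff, F.toPlane_inj]
  rcases hh.eq_or_lt with h0 | h0
  · right; rw [← h0]; simp
  · left; nlinarith [mul_pos F.s_pos h0]

theorem names_S12m (hd : 0 ≤ d) (hh : 0 ≤ h) (hdh : d ^ 2 = a ^ 2 + h ^ 2) (w : Plane) :
    m.Names .S12m w ↔ w = F.toPlane 0 (-h) := by
  unfold Measurement.Names
  rw [F.inter₁₂ hd hdh, Set.pair_comm]
  apply isFarthestPoint_pair_iff
  rw [F.Z₃_eq, F.dist_lt_iff, F.toPlane_inj]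
  rcases hh.eq_or_lt with h0 | h0
  · right; rw [← h0]; simp
  · left; nlinarith [mul_pos F.s_pos h0]

theorem names_eq (S : SegmentData a s d e h y₀ p q) (hd : 0 ≤ d) (he : 0 ≤ e) (l : PointName)
    (hl : l ≠ .N3) (w : Plane) :
    m.Names l w ↔ w = F.toPlane (nameCoord a s e h y₀ p q l).1 (nameCoord a s e h y₀ p q l).2 := by
  have hor := S.dist_or
  cases l with
  | Y0 => simp only [Measurement.Names, nameCoord, F.Y₀_eq]
  | Y3 => simp only [Measurement.Names, nameCoord, F.Y₃_eq]
  | N3 => exact absurd rfl hl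
  | S12p => exact F.names_S12p hd S.h_nonneg S.d_sq w
  | S12m => exact F.names_S12m hd S.h_nonneg S.d_sq w
  | S23p =>
    unfold Measurement.Names nameCoord
    rw [F.inter₂₃ S hd he]
    apply isNearestPoint_pair_iff
    rw [F.Z₁_eq, F.dist_lt_iff, F.toPlane_inj]
    refine hor.imp (fun h => by linear_combination h) (fun h => by simp [h])
  | S23m =>
    unfold Measurement.Names nameCoord
    rw [F.inter₂₃ S hd he, Set.pair_comm]
    apply isFarthestPoint_pair_iff
    rw [F.Z₁_eq, F.dist_lt_iff, F.toPlane_inj]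
    refine hor.imp (fun h => by linear_combination h) (fun h => by simp [h])
  | S31p =>
    unfold Measurement.Names nameCoord
    rw [F.inter₃₁ S hd he]
    apply isNearestPoint_pair_iff
    rw [F.Z₂_eq, F.dist_lt_iff, F.toPlane_inj]
    refine hor.imp (fun h => by linear_combination h) (fun h => by simp [h])
  | S31m =>
    unfold Measurement.Names nameCoord
    rw [F.inter₃₁ S hd he, Set.pair_comm]
    apply isFarthestPoint_pair_iff
    rw [F.Z₂_eq, F.dist_lt_iff, F.toPlane_inj]
    refine hor.imp (fun h => by linear_combination h) (fun h => by simp [h])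

theorem names_N3 (hd : 0 ≤ d) (he : 0 ≤ e) (h2s : e ≤ 2 * s) (hout : d ^ 2 ≤ a ^ 2 + (s - e) ^ 2)
    (w : Plane) : m.Names .N3 w ↔ w = F.toPlane 0 (s - e) := by
  have hmem : F.toPlane 0 (s - e) ∈ m.R₀₀₁ := by
    refine ⟨?_, ?_, ?_⟩
    · rw [F.d₁_eq, F.Z₁_eq, ← sq_le_sq₀ hd dist_nonneg, F.dist_sq]
      linear_combination hout
    · rw [F.d₂_eq, F.Z₂_eq, ← sq_le_sq₀ hd dist_nonneg, F.dist_sq]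
      linear_combination hout
    · rw [F.d₃_eq, F.Z₃_eq, ← sq_le_sq₀ dist_nonneg he, F.dist_sq]
      linarith
  have hlt : ∀ z ∈ m.R₀₀₁, z ≠ F.toPlane 0 (s - e) → dist (F.toPlane 0 (s - e)) m.Y₃ <
      dist z m.Y₃ := by
    rintro z ⟨-, -, h3⟩ hne
    obtain ⟨x, y, rfl⟩ := F.surj z
    rw [Ne, F.toPlane_inj] at hne
    rw [F.d₃_eq, F.Z₃_eq, ← sq_le_sq₀ dist_nonneg he, F.dist_sq] at h3
    rw [F.Y₃_eq, F.dist_lt_iff]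
    by_contra! hcon
    have hs := F.s_pos
    have hy1 : y ≤ s - e := by nlinarith
    have hy2 : s - e ≤ y := by
      have : |s - y| ≤ |e| := sq_le_sq.1 (by nlinarith [sq_nonneg x])
      rw [abs_of_nonneg he] at this
      linarith [(abs_le.1 this).2]
    have hy := le_antisymm hy1 hy2
    refine hne ⟨?_, hy⟩
    rw [hy] at hcon
    nlinarith [sq_nonneg x]
  constructor
  · rintro ⟨h1, h2⟩
    by_contra hne
    exact lt_asymm (h2 _ hmem (Ne.symm hne)) (hlt _ h1 hne)
  · rintro rfl
    exact ⟨hmem, hlt⟩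

end IsoscelesFrame

namespace IsoscelesFrame

variable {m : Measurement} {a s d e h y₀ p q : ℝ} (F : IsoscelesFrame m a s d e)
include F

theorem sourcesAre_of_segment (S : SegmentData a s d e h y₀ p q) (hd : 0 ≤ d) (he : 0 ≤ e)
    {L : Set PointName} (v : ℝ) (hne : L.Nonempty)
    (hL : ∀ l ∈ L, (l = .S12p ∧ v = 2 * s * (h - y₀)) ∨ (l = .S12m ∧ v = 2 * s * (h + y₀)) ∨
      ((l = .S23p ∨ l = .S31p) ∧ v = 4 * a * p) ∨ ((l = .S23m ∨ l = .S31m) ∧ v = -(4 * a * q)))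
    (v1 : v ≤ 2 * s * (h - y₀)) (v2 : v ≤ 2 * s * (h + y₀)) (v3 : y₀ ≤ s → v ≤ 4 * a * p)
    (v4 : s ≤ y₀ → v ≤ -(4 * a * q)) (w1 : v = 2 * s * (h - y₀) → .S12p ∈ L)
    (w2 : v = 2 * s * (h + y₀) → ∃ l ∈ L, (0, -h) = nameCoord a s e h y₀ p q l)
    (w3 : y₀ ≤ s → v = 4 * a * p → .S23p ∈ L ∧ .S31p ∈ L)
    (w4 : s ≤ y₀ → v = -(4 * a * q) → .S23m ∈ L ∧ .S31m ∈ L) : m.SourcesAre L := by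
  refine F.sourcesAre_of (nameCoord a s e h y₀ p q) v (fun l hl => F.names_eq S hd he l ?_) hne
    (fun x y => (S.planarObjective_ge v1 v2 v3 v4).1) (fun l hl => ?_) (fun x y hxy => ?_)
  · rintro rfl
    simpa using hL _ hl
  · rcases hL l hl with ⟨rfl, hv⟩ | ⟨rfl, hv⟩ | ⟨rfl | rfl, hv⟩ | ⟨rfl | rfl, hv⟩ <;> rw [hv]
    · exact S.planarObjective_near
    · exact S.planarObjective_far
    · exact (planarObjective_neg ..).trans S.planarObjective_p
    · exact S.planarObjective_p
    · exact (planarObjective_neg ..).trans S.planarObjective_q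
    · exact S.planarObjective_q
  · rcases (S.planarObjective_ge v1 v2 v3 v4).2 hxy with ⟨rfl, rfl, hv⟩ | ⟨rfl, rfl, hv⟩ |
      ⟨hc, hv, hx, rfl⟩ | ⟨hc, hv, hx, rfl⟩
    · exact ⟨_, w1 hv, rfl⟩
    · exact w2 hv
    · rcases hx with rfl | rfl
      · exact ⟨_, (w3 hc hv).2, rfl⟩
      · exact ⟨_, (w3 hc hv).1, rfl⟩
    · rcases hx with rfl | rfl
      · exact ⟨_, (w4 hc hv).2, rfl⟩
      · exact ⟨_, (w4 hc hv).1, rfl⟩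

theorem sourcesAre_Y0 (he : 0 < e) (hdA : d ^ 2 ≤ a ^ 2 + (s / 3) ^ 2)
    (hes : e ≤ 2 * s / 3) : m.SourcesAre {.Y0} := by
  have hs := F.s_pos
  refine F.sourcesAre_singleton_of_critical (z := s / 3) (c := 1) (μ := 1) (by simp) (by simp)
    (by norm_num) (by ring) ?_ ?_ (fun w => by simp only [Measurement.Names, F.Y₀_eq])
  · rw [one_mul, abs_of_nonneg (by linarith)]
  · rw [one_mul, abs_of_nonneg (by nlinarith)]

theorem sourcesAre_Y3 (hdB : d ^ 2 ≤ a ^ 2 + s ^ 2)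
    (hes : 2 * s ≤ e) : m.SourcesAre {.Y3} := by
  have hs := F.s_pos
  refine F.sourcesAre_singleton_of_critical (z := -s) (c := 1) (μ := -1) (by simp) (by simp)
    (by norm_num) (by ring) ?_ ?_ (fun w => by simp only [Measurement.Names, F.Y₃_eq])
  · rw [one_mul, abs_of_nonneg (by linarith)]
  · rw [neg_one_mul, abs_of_nonpos (by nlinarith)]

theorem sourcesAre_N3 (hd : 0 < d) (he1 : 2 * s / 3 ≤ e) (he2 : e ≤ 2 * s)
    (hout : d ^ 2 ≤ a ^ 2 + (s - e) ^ 2) : m.SourcesAre {.N3} := by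
  have hs := F.s_pos
  have he : 0 < e := by linarith
  refine F.sourcesAre_singleton_of_critical (z := s - e) (c := 1) (μ := 2 * (s - e) / e) (by simp)
    ?_ ?_ ?_ ?_ ?_ (F.names_N3 hd.le he.le he2 hout)
  · rw [abs_le, le_div_iff₀ he, div_le_iff₀ he]
    constructor <;> linarith
  · rw [mul_one, show 2 + 2 * (s - e) / e = 2 * s / e by field_simp; ring]
    positivity
  · field_simp; ring
  · rw [one_mul, abs_of_nonneg (by linarith)]
  · rw [show (s - e - s) ^ 2 - e ^ 2 = 0 by ring]; simp

theorem sourcesAre_S12p_of_critical (hd : 0 < d) (hh : s / 3 ≤ h) (hdh : d ^ 2 = a ^ 2 + h ^ 2)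
    (hes : e ^ 2 ≤ (h - s) ^ 2) : m.SourcesAre {.S12p} := by
  have hs := F.s_pos
  have hh0 : 0 < h := by linarith
  refine F.sourcesAre_singleton_of_critical (z := h) (c := (s - h) / (2 * h)) (μ := 1)
    ?_ (by simp) ?_ ?_ ?_ ?_ (F.names_S12p hd.le hh0.le hdh)
  · rw [abs_le, le_div_iff₀ (by linarith), div_le_iff₀ (by linarith)]
    constructor <;> linarith
  · rw [show 2 * ((s - h) / (2 * h)) + 1 = s / h by field_simp; ring]
    positivity
  · field_simp; ring
  · rw [show a ^ 2 + h ^ 2 - d ^ 2 = 0 by rw [hdh]; ring]; simp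
  · rw [one_mul, abs_of_nonneg (by linarith)]

theorem sourcesAre_S12m_of_critical (hd : 0 < d) (hh : s ≤ h) (hdh : d ^ 2 = a ^ 2 + h ^ 2)
    (hes : (h + s) ^ 2 ≤ e ^ 2) : m.SourcesAre {.S12m} := by
  have hs := F.s_pos
  have hh0 : 0 < h := by linarith
  refine F.sourcesAre_singleton_of_critical (z := -h) (c := (h + s) / (2 * h)) (μ := -1)
    ?_ (by simp) ?_ ?_ ?_ ?_ (F.names_S12m hd.le hh0.le hdh)
  · rw [abs_le, le_div_iff₀ (by linarith), div_le_iff₀ (by linarith)]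
    constructor <;> linarith
  · rw [show 2 * ((h + s) / (2 * h)) + -1 = s / h by field_simp; ring]
    positivity
  · field_simp; ring
  · rw [show a ^ 2 + (-h) ^ 2 - d ^ 2 = 0 by rw [hdh]; ring]; simp
  · rw [show (-h - s) ^ 2 = (h + s) ^ 2 by ring, neg_one_mul, abs_of_nonpos (by linarith)]

section Segment

variable (hd : 0 < d) (he : 0 ≤ e) (hh : 0 ≤ h) (hdh : d ^ 2 = a ^ 2 + h ^ 2)
  (hy : e ^ 2 = h ^ 2 + s ^ 2 - 2 * s * y₀)
include hd he hh hdh hy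

theorem sourcesAre_S12p (hsh : s / 3 ≤ h) (h0 : 0 < y₀) (h1 : y₀ ≤ h)
    (hR : h * (s ^ 2 - 3 * a ^ 2) + 4 * a ^ 2 * s < y₀ * (s ^ 2 + 9 * a ^ 2))
    (hS : s ≤ y₀ → (h - y₀) * (s ^ 2 + a ^ 2) < 4 * a ^ 2 * (h + s)) : m.SourcesAre {.S12p} := by
  have hs := F.s_pos
  rcases h1.eq_or_lt with h1 | h1
  · exact F.sourcesAre_S12p_of_critical hd hsh hdh (by rw [hy, h1]; linarith)
  obtain ⟨p, q, S⟩ := SegmentData.exists F.a_pos hs hh hdh hy (by linarith) h1.le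
  obtain ⟨c, hc, hcp⟩ := S.near_sub_p h1
  obtain ⟨c', hc', hcq⟩ := S.near_add_q h1
  have hp := mul_pos hc (sub_pos.2 hR)
  have hsy := mul_pos hs h0
  have hq : s ≤ y₀ → 0 < c' * (4 * a ^ 2 * (h + s) - (h - y₀) * (s ^ 2 + a ^ 2)) := fun hc =>
    mul_pos hc' (sub_pos.2 (hS hc))
  refine F.sourcesAre_of_segment S hd.le he (2 * s * (h - y₀)) (by simp) ?_ le_rfl (by linarith)
    (fun _ => by linarith) (fun hc => by linarith [hq hc]) (fun _ => rfl) (fun hc => by linarith)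
    (fun _ hc => by linarith) (fun h' hc => by linarith [hq h'])
  rintro l rfl
  simp

theorem sourcesAre_S12p_S23p_S31p (h0 : 0 < y₀) (hys : y₀ < s) (h1 : y₀ ≤ h)
    (hR : h * (s ^ 2 - 3 * a ^ 2) + 4 * a ^ 2 * s = y₀ * (s ^ 2 + 9 * a ^ 2)) :
    m.SourcesAre {.S12p, .S23p, .S31p} := by
  have hs := F.s_pos
  obtain ⟨p, q, S⟩ := SegmentData.exists F.a_pos hs hh hdh hy (by linarith) h1
  have hp : 2 * s * (h - y₀) = 4 * a * p := by
    rcases h1.eq_or_lt with h1 | h1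
    · rw [S.p_eq_zero (by rw [h1]) hys.le, h1]; ring
    · obtain ⟨c, hc, hcp⟩ := S.near_sub_p h1
      rw [hR, sub_self, mul_zero] at hcp
      linarith
  have hsy := mul_pos hs h0
  refine F.sourcesAre_of_segment S hd.le he (2 * s * (h - y₀)) (by simp) ?_ le_rfl (by linarith)
    (fun _ => by linarith) (fun hc => by linarith) (fun _ => by simp) (fun hc => by linarith)
    (fun _ hc => by simp) (fun h' hc => by linarith)
  rintro l (rfl | rfl | rfl) <;> simp [hp]

theorem sourcesAre_S23p_S31p (hys : y₀ < s) (h1 : y₀ < h) (h2 : -h ≤ y₀)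
    (hR : y₀ * (s ^ 2 + 9 * a ^ 2) < h * (s ^ 2 - 3 * a ^ 2) + 4 * a ^ 2 * s)
    (hM : -(h * (s ^ 2 - 3 * a ^ 2) + 4 * a ^ 2 * s) < y₀ * (s ^ 2 + a ^ 2)) :
    m.SourcesAre {.S23p, .S31p} := by
  have hs := F.s_pos
  obtain ⟨p, q, S⟩ := SegmentData.exists F.a_pos hs hh hdh hy h2 h1.le
  obtain ⟨c, hc, hcp⟩ := S.near_sub_p h1
  have hp := mul_pos hc (sub_pos.2 hR)
  have hfar : 4 * a * p ≤ 2 * s * (h + y₀) ∧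
      (4 * a * p = 2 * s * (h + y₀) → ∃ l ∈ ({.S23p, .S31p} : Set PointName),
        (0, -h) = nameCoord a s e h y₀ p q l) := by
    rcases h2.eq_or_lt with h2 | h2
    · have hp0 := S.p_eq_zero (by rw [← h2]; ring) hys.le
      exact ⟨by rw [hp0, ← h2]; simp, fun _ => ⟨.S23p, by simp, by simp [nameCoord, hp0, h2]⟩⟩
    · obtain ⟨c', hc', hcq⟩ := S.far_sub_p h2
      have := mul_pos hc' (neg_lt_iff_pos_add'.1 hM)
      exact ⟨by linarith, fun hh => by linarith⟩
  refine F.sourcesAre_of_segment S hd.le he (4 * a * p) (by simp) ?_ (by linarith) hfar.1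
    (fun _ => le_rfl) (fun hc => by linarith) (fun hc => by linarith) hfar.2
    (fun _ hc => by simp) (fun h' hc => by linarith)
  rintro l (rfl | rfl) <;> simp

theorem sourcesAre_S23p_S31p_S12m (h0 : y₀ < 0) (h2 : -h ≤ y₀)
    (hM : -(h * (s ^ 2 - 3 * a ^ 2) + 4 * a ^ 2 * s) = y₀ * (s ^ 2 + a ^ 2)) :
    m.SourcesAre {.S23p, .S31p, .S12m} := by
  have hs := F.s_pos
  obtain ⟨p, q, S⟩ := SegmentData.exists F.a_pos hs hh hdh hy h2 (by linarith)
  have hp : 2 * s * (h + y₀) = 4 * a * p := by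
    rcases h2.eq_or_lt with h2 | h2
    · rw [S.p_eq_zero (by rw [← h2]; ring) (by linarith), ← h2]; ring
    · obtain ⟨c, hc, hcp⟩ := S.far_sub_p h2
      rw [← hM, add_neg_cancel, mul_zero] at hcp
      linarith
  have hsy := mul_neg_of_pos_of_neg hs h0
  refine F.sourcesAre_of_segment S hd.le he (2 * s * (h + y₀)) (by simp) ?_ (by linarith) le_rfl
    (fun _ => by linarith) (fun hc => by linarith) (fun hc => by linarith)
    (fun hc => ⟨.S12m, by simp, rfl⟩) (fun _ hc => by simp) (fun h' hc => by linarith)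
  rintro l (rfl | rfl | rfl) <;> simp [hp]

theorem sourcesAre_S12m (hsh : s ≤ h) (h0 : y₀ < 0)
    (hM : y₀ * (s ^ 2 + a ^ 2) < -(h * (s ^ 2 - 3 * a ^ 2) + 4 * a ^ 2 * s)) :
    m.SourcesAre {.S12m} := by
  have hs := F.s_pos
  rcases le_or_gt y₀ (-h) with h2 | h2
  · refine F.sourcesAre_S12m_of_critical hd hsh hdh ?_
    rw [hy]
    nlinarith
  obtain ⟨p, q, S⟩ := SegmentData.exists F.a_pos hs hh hdh hy h2.le (by linarith)
  obtain ⟨c, hc, hcp⟩ := S.far_sub_p h2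
  have hp := mul_pos hc (sub_pos.2 hM)
  have hsy := mul_neg_of_pos_of_neg hs h0
  refine F.sourcesAre_of_segment S hd.le he (2 * s * (h + y₀)) (by simp) ?_ (by linarith) le_rfl
    (fun _ => by linarith) (fun hc => by linarith) (fun hc => by linarith)
    (fun hc => ⟨.S12m, by simp, rfl⟩) (fun _ hc => by linarith) (fun h' hc => by linarith)
  rintro l rfl
  simp

theorem sourcesAre_S12p_S12m_S23p_S31p (hh' : 0 < h) (h0 : y₀ = 0)
    (hκ : h * (s ^ 2 - 3 * a ^ 2) + 4 * a ^ 2 * s = 0) :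
    m.SourcesAre {.S12p, .S12m, .S23p, .S31p} := by
  have hs := F.s_pos
  subst h0
  obtain ⟨p, q, S⟩ := SegmentData.exists F.a_pos hs hh hdh hy (by linarith) (by linarith)
  obtain ⟨c, hc, hcp⟩ := S.near_sub_p hh'
  rw [hκ, zero_mul, sub_self, mul_zero] at hcp
  have hp : 2 * s * h = 4 * a * p := by linarith
  refine F.sourcesAre_of_segment S hd.le he (2 * s * h) (by simp) ?_ (by linarith) (by linarith)
    (fun _ => by linarith) (fun hc => by linarith) (fun hc => by simp)
    (fun hc => ⟨.S12m, by simp, rfl⟩) (fun _ hc => by simp) (fun h' hc => by linarith)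
  rintro l (rfl | rfl | rfl | rfl) <;> simp [hp]

theorem sourcesAre_S12p_S12m (hh' : 0 < h) (h0 : y₀ = 0)
    (hκ : h * (s ^ 2 - 3 * a ^ 2) + 4 * a ^ 2 * s < 0) :
    m.SourcesAre {.S12p, .S12m} := by
  have hs := F.s_pos
  subst h0
  obtain ⟨p, q, S⟩ := SegmentData.exists F.a_pos hs hh hdh hy (by linarith) (by linarith)
  obtain ⟨c, hc, hcp⟩ := S.near_sub_p hh'
  have hp := mul_neg_of_pos_of_neg hc hκ
  rw [zero_mul, sub_zero] at hcp
  refine F.sourcesAre_of_segment S hd.le he (2 * s * h) (by simp) ?_ (by linarith) (by linarith)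
    (fun _ => by linarith) (fun hc => by linarith) (fun hc => by simp)
    (fun hc => ⟨.S12m, by simp, rfl⟩) (fun _ hc => by linarith) (fun h' hc => by linarith)
  rintro l (rfl | rfl) <;> simp

theorem sourcesAre_S12p_S23_S31 (h1 : s < h) (h0 : y₀ = s)
    (hκ : h * (s ^ 2 - 3 * a ^ 2) + 4 * a ^ 2 * s = s * (s ^ 2 + 9 * a ^ 2)) :
    m.SourcesAre {.S12p, .S23p, .S23m, .S31p, .S31m} := by
  have hs := F.s_pos
  obtain ⟨p, q, S⟩ := SegmentData.exists F.a_pos hs hh hdh hy (by linarith) (by linarith)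
  have hpq := S.p_eq_neg_q h0
  obtain ⟨c, hc, hcp⟩ := S.near_sub_p (by linarith)
  rw [hκ, h0, sub_self, mul_zero] at hcp
  have hp : 2 * s * (h - y₀) = 4 * a * p := by rw [h0]; linarith
  have hq : 2 * s * (h - y₀) = -(4 * a * q) := by rw [hp, hpq]; ring
  have hsy := mul_pos hs hs
  refine F.sourcesAre_of_segment S hd.le he (2 * s * (h - y₀)) (by simp) ?_ le_rfl
    (by rw [h0]; linarith) (fun _ => hp.le) (fun _ => hq.le) (fun hc => by simp)
    (fun hc => by rw [h0] at hc; linarith) (fun _ hc => by simp) (fun h' hc => by simp)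
  rintro l (rfl | rfl | rfl | rfl | rfl)
  · simp
  all_goals first
    | refine Or.inr (Or.inr (Or.inl ⟨?_, hp⟩)); simp; done
    | refine Or.inr (Or.inr (Or.inr ⟨?_, hq⟩)); simp

theorem sourcesAre_S23_S31 (h1 : s < h) (h0 : y₀ = s)
    (hκ : s * (s ^ 2 + 9 * a ^ 2) < h * (s ^ 2 - 3 * a ^ 2) + 4 * a ^ 2 * s) :
    m.SourcesAre {.S23p, .S23m, .S31p, .S31m} := by
  have hs := F.s_pos
  obtain ⟨p, q, S⟩ := SegmentData.exists F.a_pos hs hh hdh hy (by linarith) (by linarith)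
  have hpq := S.p_eq_neg_q h0
  obtain ⟨c, hc, hcp⟩ := S.near_sub_p (by linarith)
  rw [h0] at hcp
  have hp := mul_pos hc (sub_pos.2 hκ)
  have hq : 4 * a * p = -(4 * a * q) := by rw [hpq]; ring
  have hsy := mul_pos hs hs
  refine F.sourcesAre_of_segment S hd.le he (4 * a * p) (by simp) ?_ (by rw [h0]; linarith)
    (by rw [h0]; linarith) (fun _ => le_rfl) (fun _ => hq.le) (fun hc => by rw [h0] at hc; linarith)
    (fun hc => by rw [h0] at hc; linarith) (fun _ hc => by simp) (fun h' hc => by simp)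
  rintro l (rfl | rfl | rfl | rfl)
  all_goals first
    | refine Or.inr (Or.inr (Or.inl ⟨?_, rfl⟩)); simp; done
    | refine Or.inr (Or.inr (Or.inr ⟨?_, hq⟩)); simp

theorem sourcesAre_S12p_S23m_S31m (hys : s < y₀) (h1 : y₀ < h)
    (hS : (h - y₀) * (s ^ 2 + a ^ 2) = 4 * a ^ 2 * (h + s)) :
    m.SourcesAre {.S12p, .S23m, .S31m} := by
  have hs := F.s_pos
  obtain ⟨p, q, S⟩ := SegmentData.exists F.a_pos hs hh hdh hy (by linarith) (by linarith)
  obtain ⟨c, hc, hcq⟩ := S.near_add_q h1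
  rw [hS, sub_self, mul_zero] at hcq
  have hq : 2 * s * (h - y₀) = -(4 * a * q) := by linarith
  have hsy := mul_pos hs (hs.trans hys)
  refine F.sourcesAre_of_segment S hd.le he (2 * s * (h - y₀)) (by simp) ?_ le_rfl
    (by linarith) (fun _ => by linarith) (fun _ => hq.le) (fun hc => by simp)
    (fun hc => by linarith) (fun _ hc => by linarith) (fun h' hc => by simp)
  rintro l (rfl | rfl | rfl) <;> simp [hq]

theorem sourcesAre_S23m_S31m (hys : s < y₀) (h1 : y₀ < h)
    (hS : 4 * a ^ 2 * (h + s) < (h - y₀) * (s ^ 2 + a ^ 2)) :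
    m.SourcesAre {.S23m, .S31m} := by
  have hs := F.s_pos
  obtain ⟨p, q, S⟩ := SegmentData.exists F.a_pos hs hh hdh hy (by linarith) (by linarith)
  obtain ⟨c, hc, hcq⟩ := S.near_add_q h1
  have hq := mul_pos hc (sub_pos.2 hS)
  have hsy := mul_pos hs (hs.trans hys)
  refine F.sourcesAre_of_segment S hd.le he (-(4 * a * q)) (by simp) ?_ (by linarith)
    (by linarith) (fun _ => by linarith) (fun _ => le_rfl) (fun hc => by linarith)
    (fun hc => by linarith) (fun _ hc => by linarith) (fun h' hc => by simp)
  rintro l (rfl | rfl) <;> simp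

end Segment

end IsoscelesFrame

section Thresholds

variable {a s d e h y y₀ z : ℝ}

theorem lt_of_lt_sqrt_level (hs : 0 < s) (he : 0 ≤ e) (hy : e ^ 2 = h ^ 2 + s ^ 2 - 2 * s * y₀)
    (hlt : e < √(h ^ 2 + s ^ 2 - 2 * s * y)) : y < y₀ := by
  rw [Real.lt_sqrt he, hy] at hlt
  exact lt_of_mul_lt_mul_left (by linarith : 2 * s * y < 2 * s * y₀) (by positivity)

theorem lt_of_sqrt_level_lt (hs : 0 < s) (hy : e ^ 2 = h ^ 2 + s ^ 2 - 2 * s * y₀)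
    (hlt : √(h ^ 2 + s ^ 2 - 2 * s * y) < e) : y₀ < y := by
  rw [Real.sqrt_lt' ((Real.sqrt_nonneg _).trans_lt hlt), hy] at hlt
  exact lt_of_mul_lt_mul_left (by linarith : 2 * s * y₀ < 2 * s * y) (by positivity)

theorem eq_of_eq_sqrt_level (hs : 0 < s) (hy : e ^ 2 = h ^ 2 + s ^ 2 - 2 * s * y₀)
    (hpos : 0 ≤ h ^ 2 + s ^ 2 - 2 * s * y) (heq : e = √(h ^ 2 + s ^ 2 - 2 * s * y)) : y₀ = y := by
  rw [heq, Real.sq_sqrt hpos] at hy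
  exact mul_left_cancel₀ (by positivity : 2 * s ≠ 0) (by linarith)

theorem level_nonneg (hs : 0 ≤ s) (hyh : y ≤ h) : 0 ≤ h ^ 2 + s ^ 2 - 2 * s * y := by
  nlinarith [sq_nonneg (h - s), mul_le_mul_of_nonneg_left hyh hs]

theorem le_of_le_sqrt_level (hs : 0 < s) (he : 0 ≤ e) (hy : e ^ 2 = h ^ 2 + s ^ 2 - 2 * s * y₀)
    (hpos : 0 ≤ h ^ 2 + s ^ 2 - 2 * s * y) (hle : e ≤ √(h ^ 2 + s ^ 2 - 2 * s * y)) : y ≤ y₀ := by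
  rcases hle.lt_or_eq with hlt | heq
  · exact (lt_of_lt_sqrt_level hs he hy hlt).le
  · exact (eq_of_eq_sqrt_level hs hy hpos heq).ge

theorem level_le_of_sub_le (hs : 0 < s) (hy : e ^ 2 = h ^ 2 + s ^ 2 - 2 * s * y₀)
    (hle : (h - s) ^ 2 ≤ e ^ 2) : y₀ ≤ h := by
  exact le_of_mul_le_mul_left (by linarith : 2 * s * y₀ ≤ 2 * s * h) (by positivity)

theorem level_lt_of_sub_lt (hs : 0 < s) (hy : e ^ 2 = h ^ 2 + s ^ 2 - 2 * s * y₀)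
    (hlt : (h - s) ^ 2 < e ^ 2) : y₀ < h := by
  exact lt_of_mul_lt_mul_left (by linarith : 2 * s * y₀ < 2 * s * h) (by positivity)

theorem neg_le_level_of_le_add (hs : 0 < s) (he : 0 ≤ e)
    (hy : e ^ 2 = h ^ 2 + s ^ 2 - 2 * s * y₀) (hle : e ≤ s + h) : -h ≤ y₀ := by
  have : e ^ 2 ≤ (s + h) ^ 2 := by gcongr
  exact le_of_mul_le_mul_left (by linarith : 2 * s * -h ≤ 2 * s * y₀) (by positivity)

theorem thresholdR_eq (hs : 0 < s) (hh : 0 ≤ h) (hdh : d ^ 2 = a ^ 2 + h ^ 2) :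
    thresholdR (2 * a) s d = √(h ^ 2 + s ^ 2 -
      2 * s * ((h * (s ^ 2 - 3 * a ^ 2) + 4 * a ^ 2 * s) / (s ^ 2 + 9 * a ^ 2))) := by
  have e1 : d ^ 2 - (2 * a) ^ 2 / 4 = h ^ 2 := by rw [hdh]; ring
  have e2 : (4 : ℝ) * s ^ 2 + 9 * (2 * a) ^ 2 = 4 * (s ^ 2 + 9 * a ^ 2) := by ring
  unfold thresholdR
  rw [e1, Real.sqrt_sq hh, e2]
  congr 1
  field_simp
  ring

theorem thresholdM_eq (hs : 0 < s) (hh : 0 ≤ h) (hdh : d ^ 2 = a ^ 2 + h ^ 2) :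
    thresholdM (2 * a) s d = √(h ^ 2 + s ^ 2 -
      2 * s * (-(h * (s ^ 2 - 3 * a ^ 2) + 4 * a ^ 2 * s) / (s ^ 2 + a ^ 2))) := by
  have e1 : d ^ 2 - (2 * a) ^ 2 / 4 = h ^ 2 := by rw [hdh]; ring
  have e2 : (4 : ℝ) * s ^ 2 + (2 * a) ^ 2 = 4 * (s ^ 2 + a ^ 2) := by ring
  unfold thresholdM
  rw [e1, Real.sqrt_sq hh, e2]
  congr 1
  field_simp
  ring

theorem thresholdP_eq (hsa : 3 * a ^ 2 < s ^ 2) : thresholdP (2 * a) s =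
    √(a ^ 2 + (s * (s ^ 2 + 5 * a ^ 2) / (s ^ 2 - 3 * a ^ 2)) ^ 2) := by
  have e2 : (4 : ℝ) * s ^ 2 - 3 * (2 * a) ^ 2 = 4 * (s ^ 2 - 3 * a ^ 2) := by ring
  have : s ^ 2 - 3 * a ^ 2 ≠ 0 := by linarith
  unfold thresholdP
  rw [e2]
  congr 1
  field_simp
  ring

theorem thresholdFlat_eq (hsa : s ^ 2 < 3 * a ^ 2) : thresholdFlat (2 * a) s =
    √(a ^ 2 + (4 * a ^ 2 * s / (3 * a ^ 2 - s ^ 2)) ^ 2) := by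
  have e2 : (3 : ℝ) * (2 * a) ^ 2 - 4 * s ^ 2 = 4 * (3 * a ^ 2 - s ^ 2) := by ring
  have : 3 * a ^ 2 - s ^ 2 ≠ 0 := by linarith
  unfold thresholdFlat
  rw [e2]
  congr 1
  field_simp
  ring

theorem sqrt_add_sq_lt_iff (hh : 0 ≤ h) (hz : 0 ≤ z) :
    √(a ^ 2 + h ^ 2) < √(a ^ 2 + z ^ 2) ↔ h < z := by
  rw [Real.sqrt_lt_sqrt_iff (by positivity), add_lt_add_iff_left, sq_lt_sq₀ hh hz]

theorem sqrt_add_sq_le_iff (hh : 0 ≤ h) (hz : 0 ≤ z) :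
    √(a ^ 2 + h ^ 2) ≤ √(a ^ 2 + z ^ 2) ↔ h ≤ z := by
  rw [Real.sqrt_le_sqrt_iff (by positivity), add_le_add_iff_left, sq_le_sq₀ hh hz]

theorem auxG_eq_zero_iff {u t : ℝ} (ha : 0 < a) (hs : 0 < s) (hsa : a ^ 2 < s ^ 2) (hu : 0 < u)
    (ht : 0 < t) :
    auxG (2 * a) s u t = 0 ↔ t * u = 4 * a ^ 2 * (u + 2 * s) / (s ^ 2 + a ^ 2) := by
  have hc : 2 * s / (s ^ 2 + (2 * a) ^ 2 / 4) ≠ 0 := by positivity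
  have hlin : 0 ≤ u * ((s ^ 2 - a ^ 2) * t + 2 * a ^ 2) := by
    have := mul_pos (sub_pos.2 hsa) ht
    positivity
  have hden : s ^ 2 + a ^ 2 ≠ 0 := by positivity
  set Δ := -s ^ 2 * u ^ 2 * t ^ 2 + 2 * s * u * (s ^ 2 + (2 * a) ^ 2 / 4 + s * u) * t +
    (2 * a) ^ 2 * u ^ 2 / 4 with hΔ
  have h1 : auxG (2 * a) s u t = 0 ↔ √Δ = u * ((s ^ 2 - a ^ 2) * t + 2 * a ^ 2) / (2 * a) := by
    unfold auxG
    rw [mul_eq_zero, or_iff_right hc, eq_div_iff (by positivity), ← hΔ]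
    constructor <;> intro hh <;> linear_combination hh
  have hkey : 4 * a ^ 2 * Δ - (u * ((s ^ 2 - a ^ 2) * t + 2 * a ^ 2)) ^ 2 =
      t * u * (s ^ 2 + a ^ 2) * (4 * a ^ 2 * (u + 2 * s) - t * u * (s ^ 2 + a ^ 2)) := by
    rw [hΔ]; ring
  rw [h1, eq_div_iff hden]
  constructor
  · intro hh
    have hpos : 0 < u * ((s ^ 2 - a ^ 2) * t + 2 * a ^ 2) / (2 * a) := by
      have := mul_pos (sub_pos.2 hsa) ht
      positivity
    have hΔ0 : 0 ≤ Δ := by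
      by_contra! hneg
      rw [Real.sqrt_eq_zero_of_nonpos hneg.le] at hh
      linarith
    have hsq : Δ = (u * ((s ^ 2 - a ^ 2) * t + 2 * a ^ 2) / (2 * a)) ^ 2 := by
      rw [← hh, Real.sq_sqrt hΔ0]
    have h0 : 4 * a ^ 2 * Δ - (u * ((s ^ 2 - a ^ 2) * t + 2 * a ^ 2)) ^ 2 = 0 := by
      rw [hsq]; field_simp; ring
    rw [hkey] at h0
    have := (mul_eq_zero.1 h0).resolve_left (by positivity)
    linarith
  · intro hh
    rw [hh, sub_self, mul_zero] at hkey
    have : Δ = (u * ((s ^ 2 - a ^ 2) * t + 2 * a ^ 2) / (2 * a)) ^ 2 := by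
      rw [div_pow, eq_div_iff (by positivity)]
      linear_combination hkey
    rw [this, Real.sqrt_sq (by positivity)]

theorem isThresholdD3_iff {δ : ℝ} (ha : 0 < a) (hs : 0 < s) (hh : 0 ≤ h)
    (hdh : d ^ 2 = a ^ 2 + h ^ 2) (hsa : 3 * a ^ 2 < s ^ 2)
    (hP : s * (s ^ 2 + 5 * a ^ 2) < h * (s ^ 2 - 3 * a ^ 2)) :
    IsThresholdD3 (2 * a) s d δ ↔
      δ = √(h ^ 2 + s ^ 2 - 2 * s * (h - 4 * a ^ 2 * (h + s) / (s ^ 2 + a ^ 2))) := by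
  have e1 : d ^ 2 - (2 * a) ^ 2 / 4 = h ^ 2 := by rw [hdh]; ring
  have hsa' : a ^ 2 < s ^ 2 := by nlinarith
  have hu : 0 < h - s := by
    by_contra! hle
    have : h * (s ^ 2 - 3 * a ^ 2) ≤ s * (s ^ 2 - 3 * a ^ 2) :=
      mul_le_mul_of_nonneg_right (by linarith) (by linarith)
    nlinarith [mul_pos hs (pow_pos ha 2)]
  have hden : 0 < s ^ 2 + a ^ 2 := by positivity
  unfold IsThresholdD3
  rw [e1, Real.sqrt_sq hh]
  constructor
  · rintro ⟨u, t, rfl, ht, hg, rfl⟩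
    rw [auxG_eq_zero_iff ha hs hsa' hu ht.1] at hg
    congr 1
    rw [show h - s + 2 * s = h + s by ring] at hg
    rw [← hg]; ring
  · rintro rfl
    have h1 : 0 < 4 * a ^ 2 * (h - s + 2 * s) / (s ^ 2 + a ^ 2) / (h - s) := by
      have : 0 < h - s + 2 * s := by linarith
      positivity
    refine ⟨h - s, 4 * a ^ 2 * (h - s + 2 * s) / (s ^ 2 + a ^ 2) / (h - s), rfl, ⟨h1, ?_⟩, ?_, ?_⟩
    · rw [div_lt_one hu, div_lt_iff₀ hden]
      linarith
    · rw [auxG_eq_zero_iff ha hs hsa' hu h1, div_mul_cancel₀ _ hu.ne']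
    · congr 1
      rw [show h - s + 2 * s = h + s by ring]
      have := hu.ne'
      field_simp
      ring

end Thresholds

theorem exists_level {s : ℝ} (hs : 0 < s) (h e : ℝ) :
    ∃ y₀, e ^ 2 = h ^ 2 + s ^ 2 - 2 * s * y₀ :=
  ⟨(h ^ 2 + s ^ 2 - e ^ 2) / (2 * s), by field_simp; ring⟩

theorem level_bounds_of_lt_thresholdM {a s d e h : ℝ} (ha : 0 < a) (hs : 0 < s) (he : 0 ≤ e)
    (hh : 0 ≤ h) (hdh : d ^ 2 = a ^ 2 + h ^ 2) (hsh : s ≤ h)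
    (hlt : e < thresholdM (2 * a) s d) :
    ∀ y₀, e ^ 2 = h ^ 2 + s ^ 2 - 2 * s * y₀ → -h ≤ y₀ ∧
      -(h * (s ^ 2 - 3 * a ^ 2) + 4 * a ^ 2 * s) < y₀ * (s ^ 2 + a ^ 2) := by
  intro y₀ hy
  have hden : 0 < s ^ 2 + a ^ 2 := by positivity
  rw [thresholdM_eq hs hh hdh] at hlt
  have h1 := lt_of_lt_sqrt_level hs he hy hlt
  have hyh : -h ≤ -(h * (s ^ 2 - 3 * a ^ 2) + 4 * a ^ 2 * s) / (s ^ 2 + a ^ 2) := by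
    rw [le_div_iff₀ hden]
    have := mul_le_mul_of_nonneg_left hsh (by positivity : 0 ≤ 4 * a ^ 2)
    linarith
  refine ⟨by linarith, ?_⟩
  rwa [div_lt_iff₀ hden] at h1

theorem level_bounds_of_le_sqrt {a s e h : ℝ} (ha : 0 < a) (hs : 0 < s) (he : 0 ≤ e) (hsh : s ≤ h)
    (hsa : 3 * a ^ 2 < s ^ 2) (hle : e ≤ √(h ^ 2 + s ^ 2)) :
    ∀ y₀, e ^ 2 = h ^ 2 + s ^ 2 - 2 * s * y₀ → -h ≤ y₀ ∧
      -(h * (s ^ 2 - 3 * a ^ 2) + 4 * a ^ 2 * s) < y₀ * (s ^ 2 + a ^ 2) := by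
  intro y₀ hy
  rw [show h ^ 2 + s ^ 2 = h ^ 2 + s ^ 2 - 2 * s * 0 by ring] at hle
  have h1 := le_of_le_sqrt_level hs he hy (level_nonneg hs.le (by linarith)) hle
  refine ⟨by linarith, ?_⟩
  have h2 : 0 ≤ y₀ * (s ^ 2 + a ^ 2) := by positivity
  have h3 : 0 < h * (s ^ 2 - 3 * a ^ 2) := mul_pos (by linarith) (by linarith)
  have h4 : 0 < 4 * a ^ 2 * s := by positivity
  linarith

namespace IsoscelesFrame

variable {m : Measurement} {a s d e h : ℝ} (F : IsoscelesFrame m a s d e)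
  (hd : 0 < d) (he : 0 ≤ e) (hh : 0 ≤ h) (hdh : d ^ 2 = a ^ 2 + h ^ 2)
include F hd he hh hdh

theorem sources_near_thresholdR (hsh : s / 3 ≤ h)
    (hκ : 0 < h * (s ^ 2 - 3 * a ^ 2) + 4 * a ^ 2 * s)
    (hP : h * (s ^ 2 - 3 * a ^ 2) < s * (s ^ 2 + 5 * a ^ 2)) :
    ((h - s) ^ 2 ≤ e ^ 2 → e < thresholdR (2 * a) s d → m.SourcesAre {.S12p}) ∧
    (e = thresholdR (2 * a) s d → m.SourcesAre {.S12p, .S23p, .S31p}) := by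
  have hs := F.s_pos
  have ha := F.a_pos
  obtain ⟨y₀, hy⟩ := exists_level hs h e
  have hden : 0 < s ^ 2 + 9 * a ^ 2 := by positivity
  rw [thresholdR_eq hs hh hdh]
  constructor
  · intro hle hlt
    have h1 := lt_of_lt_sqrt_level hs he hy hlt
    have h0 := (div_pos hκ hden).trans h1
    rw [div_lt_iff₀ hden] at h1
    refine F.sourcesAre_S12p hd he hh hdh hy hsh h0 (level_le_of_sub_le hs hy hle) h1 fun hsy => ?_
    have : (h - y₀) * (s ^ 2 + a ^ 2) ≤ (h - s) * (s ^ 2 + a ^ 2) := by gcongr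
    linarith
  · intro heq
    have hyh : (h * (s ^ 2 - 3 * a ^ 2) + 4 * a ^ 2 * s) / (s ^ 2 + 9 * a ^ 2) ≤ h := by
      rw [div_le_iff₀ hden]
      have := mul_le_mul_of_nonneg_left hsh (by positivity : 0 ≤ 12 * a ^ 2)
      linarith
    have h1 := eq_of_eq_sqrt_level hs hy (level_nonneg hs.le hyh) heq
    refine F.sourcesAre_S12p_S23p_S31p hd he hh hdh hy ?_ ?_ ?_ ?_ <;> rw [h1]
    · exact div_pos hκ hden
    · rw [div_lt_iff₀ hden]
      linarith
    · exact hyh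
    · rw [div_mul_cancel₀ _ hden.ne']

theorem sources_above_thresholdR (hsh : s / 3 ≤ h)
    (hP : h * (s ^ 2 - 3 * a ^ 2) ≤ s * (s ^ 2 + 5 * a ^ 2)) (hgt : thresholdR (2 * a) s d < e)
    (hM : ∀ y₀, e ^ 2 = h ^ 2 + s ^ 2 - 2 * s * y₀ → -h ≤ y₀ ∧
      -(h * (s ^ 2 - 3 * a ^ 2) + 4 * a ^ 2 * s) < y₀ * (s ^ 2 + a ^ 2)) :
    m.SourcesAre {.S23p, .S31p} := by
  have hs := F.s_pos
  have ha := F.a_pos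
  obtain ⟨y₀, hy⟩ := exists_level hs h e
  have hden : 0 < s ^ 2 + 9 * a ^ 2 := by positivity
  rw [thresholdR_eq hs hh hdh] at hgt
  have h1 := lt_of_sqrt_level_lt hs hy hgt
  have hyh : (h * (s ^ 2 - 3 * a ^ 2) + 4 * a ^ 2 * s) / (s ^ 2 + 9 * a ^ 2) ≤ h := by
    rw [div_le_iff₀ hden]
    have := mul_le_mul_of_nonneg_left hsh (by positivity : 0 ≤ 12 * a ^ 2)
    linarith
  have hys : (h * (s ^ 2 - 3 * a ^ 2) + 4 * a ^ 2 * s) / (s ^ 2 + 9 * a ^ 2) ≤ s := by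
    rw [div_le_iff₀ hden]
    linarith
  obtain ⟨hM1, hM2⟩ := hM y₀ hy
  refine F.sourcesAre_S23p_S31p hd he hh hdh hy (h1.trans_le hys) (h1.trans_le hyh) hM1 ?_ hM2
  rwa [lt_div_iff₀ hden] at h1

theorem sources_from_thresholdM (hsh : s ≤ h)
    (hκ : 0 < h * (s ^ 2 - 3 * a ^ 2) + 4 * a ^ 2 * s) :
    (e = thresholdM (2 * a) s d → m.SourcesAre {.S23p, .S31p, .S12m}) ∧
    (thresholdM (2 * a) s d < e → m.SourcesAre {.S12m}) := by
  have hs := F.s_pos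
  have ha := F.a_pos
  obtain ⟨y₀, hy⟩ := exists_level hs h e
  have hden : 0 < s ^ 2 + a ^ 2 := by positivity
  have hneg : -(h * (s ^ 2 - 3 * a ^ 2) + 4 * a ^ 2 * s) / (s ^ 2 + a ^ 2) < 0 :=
    div_neg_of_neg_of_pos (by linarith) hden
  rw [thresholdM_eq hs hh hdh]
  constructor
  · intro heq
    have hyh : -h ≤ -(h * (s ^ 2 - 3 * a ^ 2) + 4 * a ^ 2 * s) / (s ^ 2 + a ^ 2) := by
      rw [le_div_iff₀ hden]
      have := mul_le_mul_of_nonneg_left hsh (by positivity : 0 ≤ 4 * a ^ 2)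
      linarith
    have h1 := eq_of_eq_sqrt_level hs hy (level_nonneg hs.le (by linarith)) heq
    refine F.sourcesAre_S23p_S31p_S12m hd he hh hdh hy ?_ ?_ ?_ <;> rw [h1]
    · exact hneg
    · exact hyh
    · rw [div_mul_cancel₀ _ hden.ne']
  · intro hgt
    have h1 := lt_of_sqrt_level_lt hs hy hgt
    refine F.sourcesAre_S12m hd he hh hdh hy hsh (h1.trans hneg) ?_
    rwa [lt_div_iff₀ hden] at h1

/-- The five cases for a long first distance when both thresholds separate the regimes. -/
theorem sources_five_cases (hsh : s ≤ h) (hκ : 0 < h * (s ^ 2 - 3 * a ^ 2) + 4 * a ^ 2 * s)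
    (hP : h * (s ^ 2 - 3 * a ^ 2) < s * (s ^ 2 + 5 * a ^ 2)) :
    (e ∈ Ico (h - s) (thresholdR (2 * a) s d) → m.SourcesAre {.S12p}) ∧
    (e = thresholdR (2 * a) s d → m.SourcesAre {.S12p, .S23p, .S31p}) ∧
    (e ∈ Ioo (thresholdR (2 * a) s d) (thresholdM (2 * a) s d) → m.SourcesAre {.S23p, .S31p}) ∧
    (e = thresholdM (2 * a) s d → m.SourcesAre {.S23p, .S31p, .S12m}) ∧
    (e ∈ Ioi (thresholdM (2 * a) s d) → m.SourcesAre {.S12m}) := by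
  have hs := F.s_pos
  have hsh' : s / 3 ≤ h := by linarith
  obtain ⟨n1, n2⟩ := F.sources_near_thresholdR hd he hh hdh hsh' hκ hP
  obtain ⟨f1, f2⟩ := F.sources_from_thresholdM hd he hh hdh hsh hκ
  refine ⟨fun he' => n1 (pow_le_pow_left₀ (by linarith) he'.1 2) he'.2, n2, fun he' => ?_, f1, f2⟩
  exact F.sources_above_thresholdR hd he hh hdh hsh' hP.le he'.1
    (level_bounds_of_lt_thresholdM F.a_pos hs he hh hdh hsh he'.2)

end IsoscelesFrame

namespace IsoscelesFrame

variable {m : Measurement} {a s d e h : ℝ} (F : IsoscelesFrame m a s d e)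
  (hd : 0 < d) (he : 0 ≤ e) (hdh : d ^ 2 = a ^ 2 + h ^ 2)
include F hd he hdh

theorem sources_beyond_flat (hsh : s ≤ h) (hκ : h * (s ^ 2 - 3 * a ^ 2) + 4 * a ^ 2 * s ≤ 0) :
    (e ∈ Ico (h - s) √(h ^ 2 + s ^ 2) → m.SourcesAre {.S12p}) ∧
    (e = √(h ^ 2 + s ^ 2) → h * (s ^ 2 - 3 * a ^ 2) + 4 * a ^ 2 * s = 0 →
      m.SourcesAre {.S12p, .S12m, .S23p, .S31p}) ∧
    (e = √(h ^ 2 + s ^ 2) → h * (s ^ 2 - 3 * a ^ 2) + 4 * a ^ 2 * s < 0 →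
      m.SourcesAre {.S12p, .S12m}) ∧
    (e ∈ Ioi √(h ^ 2 + s ^ 2) → m.SourcesAre {.S12m}) := by
  have hs := F.s_pos
  have ha := F.a_pos
  have hh0 : 0 < h := hs.trans_le hsh
  obtain ⟨y₀, hy⟩ := exists_level hs h e
  rw [show h ^ 2 + s ^ 2 = h ^ 2 + s ^ 2 - 2 * s * 0 by ring]
  have hpos := level_nonneg (y := 0) hs.le hh0.le
  refine ⟨fun he' => ?_, fun he' hκ => ?_, fun he' hκ => ?_, fun he' => ?_⟩
  · have h1 := lt_of_lt_sqrt_level hs he hy he'.2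
    refine F.sourcesAre_S12p hd he hh0.le hdh hy (by linarith) h1
      (level_le_of_sub_le hs hy (pow_le_pow_left₀ (by linarith) he'.1 2)) ?_ fun hsy => ?_
    · have : 0 < y₀ * (s ^ 2 + 9 * a ^ 2) := by positivity
      linarith
    · have h2 : (h - y₀) * (s ^ 2 + a ^ 2) ≤ (h - s) * (s ^ 2 + a ^ 2) := by gcongr
      have : 0 < s * (s ^ 2 + 9 * a ^ 2) := by positivity
      linarith
  · exact F.sourcesAre_S12p_S12m_S23p_S31p hd he hh0.le hdh hy hh0
      (eq_of_eq_sqrt_level hs hy hpos he') hκ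
  · exact F.sourcesAre_S12p_S12m hd he hh0.le hdh hy hh0 (eq_of_eq_sqrt_level hs hy hpos he') hκ
  · have h1 := lt_of_sqrt_level_lt hs hy he'
    refine F.sourcesAre_S12m hd he hh0.le hdh hy hsh h1 ?_
    have := mul_neg_of_neg_of_pos h1 (by positivity : 0 < s ^ 2 + a ^ 2)
    linarith

theorem sources_sharp_at (hsh : s < h)
    (hP : h * (s ^ 2 - 3 * a ^ 2) = s * (s ^ 2 + 5 * a ^ 2)) :
    (e ∈ Ico (h - s) √(h ^ 2 - s ^ 2) → m.SourcesAre {.S12p}) ∧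
    (e = √(h ^ 2 - s ^ 2) → m.SourcesAre {.S12p, .S23p, .S23m, .S31p, .S31m}) := by
  have hs := F.s_pos
  have ha := F.a_pos
  have hh0 : 0 < h := hs.trans hsh
  obtain ⟨y₀, hy⟩ := exists_level hs h e
  rw [show h ^ 2 - s ^ 2 = h ^ 2 + s ^ 2 - 2 * s * s by ring]
  refine ⟨fun he' => ?_, fun he' => ?_⟩
  · have h1 := lt_of_lt_sqrt_level hs he hy he'.2
    have h2 := mul_lt_mul_of_pos_right h1 (by positivity : 0 < s ^ 2 + 9 * a ^ 2)
    have h3 := mul_lt_mul_of_pos_right h1 (by positivity : 0 < s ^ 2 + a ^ 2)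
    exact F.sourcesAre_S12p hd he hh0.le hdh hy (by linarith) (hs.trans h1)
      (level_le_of_sub_le hs hy (pow_le_pow_left₀ (by linarith) he'.1 2)) (by linarith)
      fun _ => by linarith
  · exact F.sourcesAre_S12p_S23_S31 hd he hh0.le hdh hy hsh
      (eq_of_eq_sqrt_level hs hy (level_nonneg hs.le hsh.le) he') (by linarith)

theorem sources_sharp_beyond (hsh : s < h)
    (hP : s * (s ^ 2 + 5 * a ^ 2) < h * (s ^ 2 - 3 * a ^ 2)) :
    (e ∈ Ioo (h - s) √(h ^ 2 + s ^ 2 - 2 * s * (h - 4 * a ^ 2 * (h + s) / (s ^ 2 + a ^ 2))) →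
      m.SourcesAre {.S12p}) ∧
    (e = √(h ^ 2 + s ^ 2 - 2 * s * (h - 4 * a ^ 2 * (h + s) / (s ^ 2 + a ^ 2))) →
      m.SourcesAre {.S12p, .S23m, .S31m}) ∧
    (e ∈ Ioo √(h ^ 2 + s ^ 2 - 2 * s * (h - 4 * a ^ 2 * (h + s) / (s ^ 2 + a ^ 2)))
      √(h ^ 2 - s ^ 2) → m.SourcesAre {.S23m, .S31m}) ∧
    (e = √(h ^ 2 - s ^ 2) → m.SourcesAre {.S23p, .S23m, .S31p, .S31m}) := by
  have hs := F.s_pos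
  have ha := F.a_pos
  have hh0 : 0 < h := hs.trans hsh
  have hden : 0 < s ^ 2 + a ^ 2 := by positivity
  have hw : 0 < 4 * a ^ 2 * (h + s) / (s ^ 2 + a ^ 2) := by positivity
  have hws : s < h - 4 * a ^ 2 * (h + s) / (s ^ 2 + a ^ 2) := by
    rw [lt_sub_comm, div_lt_iff₀ hden]
    linarith
  have hwe : (h - (h - 4 * a ^ 2 * (h + s) / (s ^ 2 + a ^ 2))) * (s ^ 2 + a ^ 2) =
      4 * a ^ 2 * (h + s) := by
    rw [sub_sub_cancel, div_mul_cancel₀ _ hden.ne']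
  set w := h - 4 * a ^ 2 * (h + s) / (s ^ 2 + a ^ 2)
  obtain ⟨y₀, hy⟩ := exists_level hs h e
  rw [show h ^ 2 - s ^ 2 = h ^ 2 + s ^ 2 - 2 * s * s by ring]
  refine ⟨fun he' => ?_, fun he' => ?_, fun he' => ?_, fun he' => ?_⟩
  · have h1 := lt_of_lt_sqrt_level hs he hy he'.2
    have h3 := mul_lt_mul_of_pos_right h1 hden
    have h4 := level_le_of_sub_le hs hy (pow_le_pow_left₀ (by linarith) he'.1.le 2)
    have h5 : 0 < 8 * a ^ 2 * (y₀ - s) := mul_pos (by positivity) (by linarith)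
    exact F.sourcesAre_S12p hd he hh0.le hdh hy (by linarith) (by linarith) h4 (by linarith)
      fun _ => by linarith
  · have h1 := eq_of_eq_sqrt_level hs hy (level_nonneg hs.le (by linarith)) he'
    exact F.sourcesAre_S12p_S23m_S31m hd he hh0.le hdh hy (by linarith) (by linarith)
      (by rw [h1, hwe])
  · have h1 := lt_of_sqrt_level_lt hs hy he'.1
    have h2 := lt_of_lt_sqrt_level hs he hy he'.2
    have h3 := mul_lt_mul_of_pos_right h1 hden
    exact F.sourcesAre_S23m_S31m hd he hh0.le hdh hy h2 (by linarith) (by linarith)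
  · exact F.sourcesAre_S23_S31 hd he hh0.le hdh hy hsh
      (eq_of_eq_sqrt_level hs hy (level_nonneg hs.le hsh.le) he') (by linarith)

/-- A pair of sources on the third circle, for a third distance above `√(h² - s²)`. -/
theorem sources_sharp_above (hsh : s < h) (hP : s * (s ^ 2 + 5 * a ^ 2) ≤ h * (s ^ 2 - 3 * a ^ 2)) (hgt : √(h ^ 2 - s ^ 2) < e)
    (hM : ∀ y₀, e ^ 2 = h ^ 2 + s ^ 2 - 2 * s * y₀ → -h ≤ y₀ ∧
      -(h * (s ^ 2 - 3 * a ^ 2) + 4 * a ^ 2 * s) < y₀ * (s ^ 2 + a ^ 2)) :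
    m.SourcesAre {.S23p, .S31p} := by
  have hs := F.s_pos
  have ha := F.a_pos
  obtain ⟨y₀, hy⟩ := exists_level hs h e
  rw [show h ^ 2 - s ^ 2 = h ^ 2 + s ^ 2 - 2 * s * s by ring] at hgt
  have h1 := lt_of_sqrt_level_lt hs hy hgt
  obtain ⟨hM1, hM2⟩ := hM y₀ hy
  have h2 := mul_lt_mul_of_pos_right h1 (by positivity : 0 < s ^ 2 + 9 * a ^ 2)
  exact F.sourcesAre_S23p_S31p hd he (hs.trans hsh).le hdh hy h1 (h1.trans hsh) hM1 (by linarith)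
    hM2

end IsoscelesFrame

theorem mainTheorem5 (m : Measurement)
    (hT : AffineIndependent ℝ ![m.Z₁, m.Z₂, m.Z₃])
    (hiso : dist m.Z₁ m.Z₃ = dist m.Z₂ m.Z₃) (hd : m.d₁ = m.d₂)
    (r s d₁ d₃ : ℝ) (hr : r = dist m.Z₁ m.Z₂) (hs : s = dist m.Z₃ (midpoint ℝ m.Z₁ m.Z₂))
    (hd₁ : d₁ = m.d₁) (hd₃ : d₃ = m.d₃) :
    (d₁ ∈ Ioc 0 √(r ^ 2 / 4 + s ^ 2 / 9) → d₃ ∈ Ioc 0 (2 * s / 3) → m.SourcesAre {.Y0}) ∧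
    (d₁ ∈ Ioc 0 √(r ^ 2 / 4 + s ^ 2) → d₃ ∈ Ici (2 * s) → m.SourcesAre {.Y3}) ∧
    (d₁ ∈ Ioc 0 (r / 2) → d₃ ∈ Icc (2 * s / 3) (2 * s) → m.SourcesAre {.N3}) ∧
    (d₁ ∈ Ioc (r / 2) √(r ^ 2 / 4 + s ^ 2 / 9) → d₃ ∈ Icc (2 * s / 3) (s - √(d₁ ^ 2 - r ^ 2 / 4)) → m.SourcesAre {.N3}) ∧
    (d₁ ∈ Ioc (r / 2) √(r ^ 2 / 4 + s ^ 2) → d₃ ∈ Icc (s + √(d₁ ^ 2 - r ^ 2 / 4)) (2 * s) → m.SourcesAre {.N3}) ∧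
    (d₁ ∈ Ioo (r / 2) √(r ^ 2 / 4 + s ^ 2 / 9) → d₃ ∈ Ioo (s - √(d₁ ^ 2 - r ^ 2 / 4)) (s + √(d₁ ^ 2 - r ^ 2 / 4)) → m.SourcesAre {.S23p, .S31p}) ∧
    (d₁ ∈ Ici √(r ^ 2 / 4 + s ^ 2 / 9) → d₃ ∈ Ioc 0 |s - √(d₁ ^ 2 - r ^ 2 / 4)| → m.SourcesAre {.S12p}) ∧
    (d₁ ∈ Ico √(r ^ 2 / 4 + s ^ 2 / 9) √(r ^ 2 / 4 + s ^ 2) →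
      (d₃ ∈ Ico (s - √(d₁ ^ 2 - r ^ 2 / 4)) (thresholdR r s d₁) → m.SourcesAre {.S12p}) ∧
      (d₃ = thresholdR r s d₁ → m.SourcesAre {.S12p, .S23p, .S31p}) ∧
      (d₃ ∈ Ioc (thresholdR r s d₁) (s + √(d₁ ^ 2 - r ^ 2 / 4)) → m.SourcesAre {.S23p, .S31p})) ∧
    (s < √3 * r / 2 →
      (d₁ ∈ Ico √(r ^ 2 / 4 + s ^ 2) (thresholdFlat r s) →
        (d₃ ∈ Ico (√(d₁ ^ 2 - r ^ 2 / 4) - s) (thresholdR r s d₁) → m.SourcesAre {.S12p}) ∧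
        (d₃ = thresholdR r s d₁ → m.SourcesAre {.S12p, .S23p, .S31p}) ∧
        (d₃ ∈ Ioo (thresholdR r s d₁) (thresholdM r s d₁) → m.SourcesAre {.S23p, .S31p}) ∧
        (d₃ = thresholdM r s d₁ → m.SourcesAre {.S23p, .S31p, .S12m}) ∧
        (d₃ ∈ Ioi (thresholdM r s d₁) → m.SourcesAre {.S12m})) ∧
      (d₁ = thresholdFlat r s →
        (d₃ ∈ Ico (√(d₁ ^ 2 - r ^ 2 / 4) - s) √(d₁ ^ 2 - r ^ 2 / 4 + s ^ 2) → m.SourcesAre {.S12p}) ∧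
        (d₃ = √(d₁ ^ 2 - r ^ 2 / 4 + s ^ 2) → m.SourcesAre {.S12p, .S12m, .S23p, .S31p}) ∧
        (d₃ ∈ Ioi √(d₁ ^ 2 - r ^ 2 / 4 + s ^ 2) → m.SourcesAre {.S12m})) ∧
      (d₁ ∈ Ioi (thresholdFlat r s) →
        (d₃ ∈ Ico (√(d₁ ^ 2 - r ^ 2 / 4) - s) √(d₁ ^ 2 - r ^ 2 / 4 + s ^ 2) → m.SourcesAre {.S12p}) ∧
        (d₃ = √(d₁ ^ 2 - r ^ 2 / 4 + s ^ 2) → m.SourcesAre {.S12p, .S12m}) ∧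
        (d₃ ∈ Ioi √(d₁ ^ 2 - r ^ 2 / 4 + s ^ 2) → m.SourcesAre {.S12m}))) ∧
    (s = √3 * r / 2 →
      (d₁ ∈ Ici √(r ^ 2 / 4 + s ^ 2) →
        (d₃ ∈ Ico (√(d₁ ^ 2 - r ^ 2 / 4) - s) (thresholdR r s d₁) → m.SourcesAre {.S12p}) ∧
        (d₃ = thresholdR r s d₁ → m.SourcesAre {.S12p, .S23p, .S31p}) ∧
        (d₃ ∈ Ioo (thresholdR r s d₁) (thresholdM r s d₁) → m.SourcesAre {.S23p, .S31p}) ∧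
        (d₃ = thresholdM r s d₁ → m.SourcesAre {.S23p, .S31p, .S12m}) ∧
        (d₃ ∈ Ioi (thresholdM r s d₁) → m.SourcesAre {.S12m}))) ∧
    (√3 * r / 2 < s →
      (d₁ ∈ Ico √(r ^ 2 / 4 + s ^ 2) (thresholdP r s) →
        (d₃ ∈ Ico (√(d₁ ^ 2 - r ^ 2 / 4) - s) (thresholdR r s d₁) → m.SourcesAre {.S12p}) ∧
        (d₃ = thresholdR r s d₁ → m.SourcesAre {.S12p, .S23p, .S31p}) ∧
        (d₃ ∈ Ioc (thresholdR r s d₁) √(d₁ ^ 2 - r ^ 2 / 4 + s ^ 2) → m.SourcesAre {.S23p, .S31p})) ∧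
      (d₁ = thresholdP r s →
        (d₃ ∈ Ico (√(d₁ ^ 2 - r ^ 2 / 4) - s) √(d₁ ^ 2 - r ^ 2 / 4 - s ^ 2) → m.SourcesAre {.S12p}) ∧
        (d₃ = √(d₁ ^ 2 - r ^ 2 / 4 - s ^ 2) → m.SourcesAre {.S12p, .S23p, .S23m, .S31p, .S31m}) ∧
        (d₃ ∈ Ioc √(d₁ ^ 2 - r ^ 2 / 4 - s ^ 2) √(d₁ ^ 2 - r ^ 2 / 4 + s ^ 2) → m.SourcesAre {.S23p, .S31p})) ∧
      (d₁ ∈ Ioi (thresholdP r s) →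
        (∃! δ, IsThresholdD3 r s d₁ δ) ∧
        (∀ δ, IsThresholdD3 r s d₁ δ →
          δ ∈ Ioo (√(d₁ ^ 2 - r ^ 2 / 4) - s) √(d₁ ^ 2 - r ^ 2 / 4 - s ^ 2) ∧
          (d₃ ∈ Ioo (√(d₁ ^ 2 - r ^ 2 / 4) - s) δ → m.SourcesAre {.S12p}) ∧
          (d₃ = δ → m.SourcesAre {.S12p, .S23m, .S31m}) ∧
          (d₃ ∈ Ioo δ √(d₁ ^ 2 - r ^ 2 / 4 - s ^ 2) → m.SourcesAre {.S23m, .S31m})) ∧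
        (d₃ = √(d₁ ^ 2 - r ^ 2 / 4 - s ^ 2) → m.SourcesAre {.S23p, .S23m, .S31p, .S31m}) ∧
        (d₃ ∈ Ioc √(d₁ ^ 2 - r ^ 2 / 4 - s ^ 2) √(d₁ ^ 2 - r ^ 2 / 4 + s ^ 2) → m.SourcesAre {.S23p, .S31p})) ∧
      (d₁ ∈ Ici √(r ^ 2 / 4 + s ^ 2) →
        (d₃ ∈ Ioo √(d₁ ^ 2 - r ^ 2 / 4 + s ^ 2) (thresholdM r s d₁) → m.SourcesAre {.S23p, .S31p}) ∧
        (d₃ = thresholdM r s d₁ → m.SourcesAre {.S23p, .S31p, .S12m}) ∧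
        (d₃ ∈ Ioi (thresholdM r s d₁) → m.SourcesAre {.S12m}))) := by
  obtain ⟨F⟩ := m.exists_isoscelesFrame hT hiso hd
  rw [← hr, ← hs, ← hd₁, ← hd₃] at F
  clear hr hs hd₁ hd₃ hT hiso hd
  obtain ⟨a, rfl⟩ : ∃ a, r = 2 * a := ⟨r / 2, by ring⟩
  rw [mul_div_cancel_left₀ a two_ne_zero] at F ⊢
  have ha := F.a_pos
  have hs := F.s_pos
  rw [show (2 * a) ^ 2 / 4 + s ^ 2 / 9 = a ^ 2 + (s / 3) ^ 2 by ring,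
    show (2 * a) ^ 2 / 4 = a ^ 2 by ring, show √3 * (2 * a) / 2 = √3 * a by ring]
  have hs3 : 0 ≤ s / 3 := by positivity
  have h3a : (√3 * a) ^ 2 = 3 * a ^ 2 := by rw [mul_pow, Real.sq_sqrt (by norm_num)]
  have h3a0 : 0 ≤ √3 * a := by positivity
  have hlvl : ∀ z, a ≤ √(a ^ 2 + z ^ 2) := fun z =>
    Real.le_sqrt_of_sq_le (by linarith [sq_nonneg z])
  obtain ⟨h, hhdef⟩ : ∃ h, h = √(d₁ ^ 2 - a ^ 2) := ⟨_, rfl⟩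
  have hh : 0 ≤ h := hhdef ▸ Real.sqrt_nonneg _
  have hdh : a ≤ d₁ → d₁ ^ 2 = a ^ 2 + h ^ 2 := fun had => by
    rw [hhdef, Real.sq_sqrt (by nlinarith)]
    ring
  have hdeq : a ≤ d₁ → d₁ = √(a ^ 2 + h ^ 2) := fun had => by
    rw [← hdh had, Real.sqrt_sq (by linarith)]
  have hlt : ∀ z, 0 ≤ z → a ≤ d₁ → d₁ < √(a ^ 2 + z ^ 2) → h < z := fun z hz had hd => by
    rwa [hdeq had, sqrt_add_sq_lt_iff hh hz] at hd
  have hgt : ∀ z, 0 ≤ z → √(a ^ 2 + z ^ 2) < d₁ → z < h := fun z hz hd => by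
    rwa [hdeq ((hlvl z).trans hd.le), sqrt_add_sq_lt_iff hz hh] at hd
  have hge : ∀ z, 0 ≤ z → √(a ^ 2 + z ^ 2) ≤ d₁ → z ≤ h := fun z hz hd => by
    rwa [hdeq ((hlvl z).trans hd), sqrt_add_sq_le_iff hz hh] at hd
  have hsq : ∀ z, 0 ≤ d₁ → d₁ ≤ √(a ^ 2 + z ^ 2) → d₁ ^ 2 ≤ a ^ 2 + z ^ 2 := fun z hd0 hd => by
    have := pow_le_pow_left₀ hd0 hd 2
    rwa [Real.sq_sqrt (by positivity)] at this
  have hplus : a ≤ d₁ → d₁ ^ 2 - a ^ 2 + s ^ 2 = h ^ 2 + s ^ 2 := fun had => by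
    rw [hdh had]; ring
  have hminus : a ≤ d₁ → d₁ ^ 2 - a ^ 2 - s ^ 2 = h ^ 2 - s ^ 2 := fun had => by
    rw [hdh had]; ring
  rw [← hhdef]
  refine ⟨?_, ?_, ?_, ?_, ?_, ?_, ?_, ?_, ?_, ?_, ?_⟩
  · exact fun hd he => F.sourcesAre_Y0 he.1 (hsq _ hd.1.le hd.2) he.2
  · exact fun hd he => F.sourcesAre_Y3 (hsq _ hd.1.le hd.2) he
  · exact fun hd he => F.sourcesAre_N3 hd.1 he.1 he.2
      (by nlinarith [hd.1, hd.2, sq_nonneg (s - d₃)])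
  · intro hd he
    refine F.sourcesAre_N3 (ha.trans hd.1) he.1 (by linarith [he.2]) ?_
    rw [hdh hd.1.le]
    nlinarith [he.2]
  · intro hd he
    refine F.sourcesAre_N3 (ha.trans hd.1) (by linarith [he.1]) he.2 ?_
    rw [hdh hd.1.le]
    nlinarith [he.1]
  · intro hd he
    have hh3 := hlt _ hs3 hd.1.le hd.2
    obtain ⟨y₀, hy⟩ := exists_level hs h d₃
    have he0 : 0 < d₃ := by linarith [he.1]
    have h1 : y₀ < h := level_lt_of_sub_lt hs hy (by nlinarith [he.1])
    have h2 : -h ≤ y₀ := neg_le_level_of_le_add hs he0.le hy he.2.le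
    have h4 := mul_lt_mul_of_pos_right h1 (by positivity : 0 < s ^ 2 + 9 * a ^ 2)
    have h5 := mul_lt_mul_of_pos_left hh3 (by positivity : 0 < 12 * a ^ 2)
    have h6 := mul_le_mul_of_nonneg_right h2 (by positivity : 0 ≤ s ^ 2 + a ^ 2)
    have h7 := mul_nonneg hh (by positivity : 0 ≤ a ^ 2)
    exact F.sourcesAre_S23p_S31p (ha.trans hd.1) he0.le hh (hdh hd.1.le) hy (by linarith) h1 h2
      (by linarith) (by linarith)
  · intro hd he
    have had := (hlvl _).trans hd
    refine F.sourcesAre_S12p_of_critical (ha.trans_le had) (hge _ hs3 hd) (hdh had) ?_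
    rw [← sq_abs (h - s), abs_sub_comm]
    exact pow_le_pow_left₀ he.1.le he.2 2
  · intro hd
    have had := (hlvl _).trans hd.1
    have hd0 := ha.trans_le had
    have hh3 := hge _ hs3 hd.1
    have hhs := hlt _ hs.le had hd.2
    have hκ : 0 < h * (s ^ 2 - 3 * a ^ 2) + 4 * a ^ 2 * s := by
      have h1 := mul_pos (sub_pos.2 hhs) (by positivity : 0 < 4 * a ^ 2)
      have h2 : 0 ≤ h * (s ^ 2 + a ^ 2) := by positivity
      linarith
    have hP : h * (s ^ 2 - 3 * a ^ 2) < s * (s ^ 2 + 5 * a ^ 2) := by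
      have h1 := mul_pos (sub_pos.2 hhs) (by positivity : 0 < s ^ 2)
      have h2 : 0 ≤ h * a ^ 2 := by positivity
      have h3 : 0 < s * a ^ 2 := by positivity
      linarith
    refine ⟨fun he => ?_, fun he => ?_, fun he => ?_⟩
    · have he0 : 0 ≤ d₃ := by linarith [he.1]
      refine (F.sources_near_thresholdR hd0 he0 hh (hdh had) hh3 hκ hP).1 ?_ he.2
      nlinarith [he.1]
    · have he0 : 0 ≤ d₃ := he ▸ Real.sqrt_nonneg _
      exact (F.sources_near_thresholdR hd0 he0 hh (hdh had) hh3 hκ hP).2 he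
    · have he0 : 0 ≤ d₃ := (Real.sqrt_nonneg _).trans he.1.le
      refine F.sources_above_thresholdR hd0 he0 hh (hdh had) hh3 hP.le he.1 fun y₀ hy => ?_
      have h2 : -h ≤ y₀ := neg_le_level_of_le_add hs he0 hy he.2
      have h6 := mul_le_mul_of_nonneg_right h2 (by positivity : 0 ≤ s ^ 2 + a ^ 2)
      have h1 := mul_pos (sub_pos.2 hhs) (by positivity : 0 < 4 * a ^ 2)
      exact ⟨h2, by linarith⟩
  · intro hsa
    replace hsa : s ^ 2 < 3 * a ^ 2 := h3a ▸ pow_lt_pow_left₀ hsa hs.le two_ne_zero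
    rw [thresholdFlat_eq hsa]
    have hden : 0 < 3 * a ^ 2 - s ^ 2 := by linarith
    have hF0 : 0 ≤ 4 * a ^ 2 * s / (3 * a ^ 2 - s ^ 2) := by positivity
    have hFs : s ≤ 4 * a ^ 2 * s / (3 * a ^ 2 - s ^ 2) := by
      rw [le_div_iff₀ hden]
      have h1 : 0 < s * a ^ 2 := by positivity
      have h2 : 0 < s * s ^ 2 := by positivity
      linarith
    refine ⟨fun hd => ?_, fun hd => ?_, fun hd => ?_⟩
    · have had := (hlvl _).trans hd.1
      have hd0 := ha.trans_le had
      have hsh := hge _ hs.le hd.1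
      have hhF := hlt _ hF0 had hd.2
      rw [lt_div_iff₀ hden] at hhF
      have hP : h * (s ^ 2 - 3 * a ^ 2) < s * (s ^ 2 + 5 * a ^ 2) := by
        have h1 : 0 ≤ h * (3 * a ^ 2 - s ^ 2) := by positivity
        have h2 : 0 < s * (s ^ 2 + 5 * a ^ 2) := by positivity
        linarith
      have key := fun he : 0 ≤ d₃ =>
        F.sources_five_cases hd0 he hh (hdh had) hsh (by linarith) hP
      exact ⟨fun he => (key (by linarith [he.1])).1 he,
        fun he => (key (he ▸ Real.sqrt_nonneg _)).2.1 he,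
        fun he => (key ((Real.sqrt_nonneg _).trans he.1.le)).2.2.1 he,
        fun he => (key (he ▸ Real.sqrt_nonneg _)).2.2.2.1 he,
        fun he => (key ((Real.sqrt_nonneg _).trans (le_of_lt he))).2.2.2.2 he⟩
    · have had := (hlvl _).trans hd.ge
      have hd0 := ha.trans_le had
      have hhF : h = 4 * a ^ 2 * s / (3 * a ^ 2 - s ^ 2) := by
        refine le_antisymm ?_ (hge _ hF0 hd.ge)
        rw [← sqrt_add_sq_le_iff (a := a) hh hF0, ← hdeq had]
        exact hd.le
      have hsh : s ≤ h := hhF ▸ hFs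
      rw [eq_div_iff hden.ne'] at hhF
      have key := fun he : 0 ≤ d₃ =>
        F.sources_beyond_flat hd0 he (hdh had) hsh (by linarith)
      rw [hplus had]
      exact ⟨fun he => (key (by linarith [he.1])).1 he,
        fun he => (key (he ▸ Real.sqrt_nonneg _)).2.1 he (by linarith),
        fun he => (key ((Real.sqrt_nonneg _).trans (le_of_lt he))).2.2.2 he⟩
    · have had := (hlvl _).trans (le_of_lt hd)
      have hd0 := ha.trans_le had
      have hhF := hgt _ hF0 hd
      have hsh : s ≤ h := hFs.trans hhF.le
      rw [div_lt_iff₀ hden] at hhF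
      have key := fun he : 0 ≤ d₃ =>
        F.sources_beyond_flat hd0 he (hdh had) hsh (by linarith)
      rw [hplus had]
      exact ⟨fun he => (key (by linarith [he.1])).1 he,
        fun he => (key (he ▸ Real.sqrt_nonneg _)).2.2.1 he (by linarith),
        fun he => (key ((Real.sqrt_nonneg _).trans (le_of_lt he))).2.2.2 he⟩
  · intro hsa hd
    replace hsa : s ^ 2 = 3 * a ^ 2 := by rw [hsa, h3a]
    have had := (hlvl _).trans hd
    have hd0 := ha.trans_le had
    have hsh := hge _ hs.le hd
    have hκ : 0 < h * (s ^ 2 - 3 * a ^ 2) + 4 * a ^ 2 * s := by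
      rw [hsa, sub_self, mul_zero, zero_add]; positivity
    have hP : h * (s ^ 2 - 3 * a ^ 2) < s * (s ^ 2 + 5 * a ^ 2) := by
      rw [sub_eq_zero.2 hsa, mul_zero]; positivity
    have key := fun he : 0 ≤ d₃ => F.sources_five_cases hd0 he hh (hdh had) hsh hκ hP
    exact ⟨fun he => (key (by linarith [he.1])).1 he,
      fun he => (key (he ▸ Real.sqrt_nonneg _)).2.1 he,
      fun he => (key ((Real.sqrt_nonneg _).trans he.1.le)).2.2.1 he,
      fun he => (key (he ▸ Real.sqrt_nonneg _)).2.2.2.1 he,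
      fun he => (key ((Real.sqrt_nonneg _).trans (le_of_lt he))).2.2.2.2 he⟩
  · intro hsa
    replace hsa : 3 * a ^ 2 < s ^ 2 := h3a ▸ pow_lt_pow_left₀ hsa h3a0 two_ne_zero
    rw [thresholdP_eq hsa]
    have hden : 0 < s ^ 2 - 3 * a ^ 2 := by linarith
    have hP0 : 0 ≤ s * (s ^ 2 + 5 * a ^ 2) / (s ^ 2 - 3 * a ^ 2) := by positivity
    have hPs : s < s * (s ^ 2 + 5 * a ^ 2) / (s ^ 2 - 3 * a ^ 2) := by
      rw [lt_div_iff₀ hden]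
      have h1 : 0 < s * a ^ 2 := by positivity
      linarith
    have hκ : 0 < h * (s ^ 2 - 3 * a ^ 2) + 4 * a ^ 2 * s := by positivity
    refine ⟨fun hd => ?_, fun hd => ?_, fun hd => ?_, fun hd => ?_⟩
    · have had := (hlvl _).trans hd.1
      have hd0 := ha.trans_le had
      have hsh := hge _ hs.le hd.1
      have hsh' : s / 3 ≤ h := by linarith
      have hhP := hlt _ hP0 had hd.2
      rw [lt_div_iff₀ hden] at hhP
      rw [hplus had]
      refine ⟨fun he => ?_, fun he => ?_, fun he => ?_⟩
      · have he0 : 0 ≤ d₃ := by linarith [he.1]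
        exact (F.sources_near_thresholdR hd0 he0 hh (hdh had) hsh' hκ hhP).1
          (pow_le_pow_left₀ (by linarith) he.1 2) he.2
      · have he0 : 0 ≤ d₃ := he ▸ Real.sqrt_nonneg _
        exact (F.sources_near_thresholdR hd0 he0 hh (hdh had) hsh' hκ hhP).2 he
      · have he0 : 0 ≤ d₃ := (Real.sqrt_nonneg _).trans he.1.le
        exact F.sources_above_thresholdR hd0 he0 hh (hdh had) hsh' hhP.le he.1
          (level_bounds_of_le_sqrt ha hs he0 hsh hsa he.2)
    · have had := (hlvl _).trans hd.ge
      have hd0 := ha.trans_le had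
      have hhP : h = s * (s ^ 2 + 5 * a ^ 2) / (s ^ 2 - 3 * a ^ 2) := by
        refine le_antisymm ?_ (hge _ hP0 hd.ge)
        rw [← sqrt_add_sq_le_iff (a := a) hh hP0, ← hdeq had]
        exact hd.le
      have hsh : s < h := hhP ▸ hPs
      rw [eq_div_iff hden.ne'] at hhP
      rw [hplus had, hminus had]
      refine ⟨fun he => ?_, fun he => ?_, fun he => ?_⟩
      · exact (F.sources_sharp_at hd0 (by linarith [he.1]) (hdh had) hsh hhP).1 he
      · exact (F.sources_sharp_at hd0 (he ▸ Real.sqrt_nonneg _) (hdh had) hsh hhP).2 he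
      · have he0 : 0 ≤ d₃ := (Real.sqrt_nonneg _).trans he.1.le
        exact F.sources_sharp_above hd0 he0 (hdh had) hsh hhP.ge he.1
          (level_bounds_of_le_sqrt ha hs he0 hsh.le hsa he.2)
    · have had := (hlvl _).trans (le_of_lt hd)
      have hd0 := ha.trans_le had
      have hhP := hgt _ hP0 hd
      have hsh : s < h := hPs.trans hhP
      rw [div_lt_iff₀ hden] at hhP
      have key := fun he : 0 ≤ d₃ => F.sources_sharp_beyond hd0 he (hdh had) hsh hhP
      have hiff := fun δ => isThresholdD3_iff (δ := δ) ha hs hh (hdh had) hsa hhP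
      rw [hplus had, hminus had]
      refine ⟨⟨_, (hiff _).2 rfl, fun δ hδ => (hiff δ).1 hδ⟩, fun δ hδ => ?_, fun he => ?_,
        fun he => ?_⟩
      · rw [hiff] at hδ
        subst hδ
        refine ⟨⟨?_, ?_⟩, fun he => (key (by linarith [he.1])).1 he,
          fun he => (key (he ▸ Real.sqrt_nonneg _)).2.1 he,
          fun he => (key ((Real.sqrt_nonneg _).trans he.1.le)).2.2.1 he⟩
        · apply Real.lt_sqrt_of_sq_lt
          have h1 : 0 < 2 * s * (4 * a ^ 2 * (h + s) / (s ^ 2 + a ^ 2)) := by positivity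
          linarith
        · rw [Real.sqrt_lt_sqrt_iff_of_pos (by nlinarith)]
          have h1 : 4 * a ^ 2 * (h + s) / (s ^ 2 + a ^ 2) < h - s := by
            rw [div_lt_iff₀ (by positivity)]
            linarith
          have h2 := mul_pos (by positivity : 0 < 2 * s) (sub_pos.2 h1)
          linarith
      · exact (key (he ▸ Real.sqrt_nonneg _)).2.2.2 he
      · have he0 : 0 ≤ d₃ := (Real.sqrt_nonneg _).trans he.1.le
        exact F.sources_sharp_above hd0 he0 (hdh had) hsh hhP.le he.1
          (level_bounds_of_le_sqrt ha hs he0 hsh.le hsa he.2)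
    · have had := (hlvl _).trans hd
      have hd0 := ha.trans_le had
      have hsh := hge _ hs.le hd
      have key := fun he : 0 ≤ d₃ => F.sources_from_thresholdM hd0 he hh (hdh had) hsh hκ
      refine ⟨fun he => ?_, fun he => (key (he ▸ Real.sqrt_nonneg _)).1 he,
        fun he => (key ((Real.sqrt_nonneg _).trans (le_of_lt he))).2 he⟩
      rw [hplus had] at he
      have he0 : 0 ≤ d₃ := (Real.sqrt_nonneg _).trans he.1.le
      obtain ⟨y₀, hy⟩ := exists_level hs h d₃
      have h1 : y₀ < 0 := lt_of_sqrt_level_lt hs hy (by simpa using he.1)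
      obtain ⟨hM1, hM2⟩ := level_bounds_of_lt_thresholdM ha hs he0 hh (hdh had) hsh he.2 y₀ hy
      have h2 := mul_neg_of_neg_of_pos h1 (by positivity : 0 < s ^ 2 + 9 * a ^ 2)
      exact F.sourcesAre_S23p_S31p hd0 he0 hh (hdh had) hy (by linarith) (by linarith) hM1
        (by linarith) hM2
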